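/- Fix $m\in\mathbb N\cup\{0\}$. Let $\eta_-,\eta_+$ be two distinct parallel lines in $\mathbb R^2$. For a regular curve $\gamma:[-1,1]\to\mathbb R^2$ let $s$ be arclength, $\tau=\gamma_s$ the unit tangent, $\nu$ the unit normal obtained by rotating $\tau$ anticlockwise by $\pi/2$, $k$ the curvature ($\gamma_{ss}=k\nu$), and $k_{s^n}$ its $n$-th arclength derivative. A curve satisfies the *generalised Neumann conditions* if $\gamma(\pm1)\in\eta_\pm$, $\gamma$ meets $\eta_\pm$ orthogonally at $x=\pm1$, and $k_{s^{2j+1}}(\pm1)=0$ for $0\le j\le m$. A *solution on $[0,T)$ of the polyharmonic curve diffusion flow* is a family of smooth regular curves $\gamma(\cdot,t):[-1,1]\to\mathbb R^2$, $0\le t<T$, satisfying the generalised Neumann conditions for every $t\in[0,T)$, which is smooth on $[-1,1]\times(0,T)$, whose $x$-derivatives up to order $2$ are continuous on $[-1,1]\times[0,T)$, and which satisfies $$\frac{\partial\gamma}{\partial t}=(-1)^{m+1}k_{s^{2m+2}}\,\nu\qquad\text{on }[-1,1]\times(0,T).$$ Proposition 3.2. For every $m\in\mathbb N\cup\{0\}$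 there is a constant $\varepsilon>0$, depending only on $m$, such that for every $L_0>0$ there is a $\delta>0$, depending only on $m$, $\varepsilon$ and $L_0$, with the following property. Let $\gamma$ be a solution on $[0,T)$ of the polyharmonic curve diffusion flow (for any pair of distinct parallel lines and any $T>0$) whose initial curve $\gamma_0=\gamma(\cdot,0)$ has length $L_0$ and curvature $\kappa$ that is small in the scale-invariant $L^2$-sense $$L_0\int\kappa^2\,ds\le\varepsilon .$$ Then $$\int k^2\,ds\;\le\;\int\kappa^2\,ds\cdot\exp(-\delta t)\qquad\text{for all }t\in[0,T).$$ -/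

import Mathlib

open scoped ContDiff

namespace PolyFlow

/-- The Euclidean plane. -/
abbrev Plane : Type := EuclideanSpace ℝ (Fin 2)

/-- The parameter interval `[-1, 1]` of all curves. -/
def I : Set ℝ := Set.Icc (-1) 1

/-- Anticlockwise rotation by a right angle. -/
noncomputable def rot (v : Plane) : Plane := !₂[-v 1, v 0]

/-- The parameter derivative `γ_x` on `[-1, 1]` (one-sided at the end points). -/
noncomputable def velocity (γ : ℝ → Plane) (x : ℝ) : Plane := derivWithin γ I x

/-- The line element `|γ_x|`, so that `ds = |γ_x| dx`. -/
noncomputable def speed (γ : ℝ → Plane) (x : ℝ) : ℝ := ‖velocity γ x‖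

/-- The arclength derivative `f_s = f_x / |γ_x|` of a function `f` along `γ`. -/
noncomputable def arcDeriv {F : Type*} [NormedAddCommGroup F] [NormedSpace ℝ F]
    (γ : ℝ → Plane) (f : ℝ → F) (x : ℝ) : F :=
  (speed γ x)⁻¹ • derivWithin f I x

/-- The unit tangent `τ = γ_s`. -/
noncomputable def tangent (γ : ℝ → Plane) : ℝ → Plane := arcDeriv γ γ

/-- The unit normal `ν`, the anticlockwise rotation of the unit tangent. -/
noncomputable def normal (γ : ℝ → Plane) (x : ℝ) : Plane := rot (tangent γ x)

/-- The signed curvature `k = ⟨τ_s, ν⟩`, so that `γ_ss = k ν`. (The product `k ν`, hence the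
flow below, does not depend on the choice of the sign of `ν`.) -/
noncomputable def curvature (γ : ℝ → Plane) (x : ℝ) : ℝ :=
  inner ℝ (arcDeriv γ (tangent γ) x) (normal γ x)

/-- The iterated arclength derivative of curvature, `k_{s^n}`. -/
noncomputable def curvatureDeriv (γ : ℝ → Plane) (n : ℕ) : ℝ → ℝ :=
  (arcDeriv γ)^[n] (curvature γ)

/-- The length `L[γ] = ∫ ds`. -/
noncomputable def length (γ : ℝ → Plane) : ℝ := ∫ x in (-1 : ℝ)..1, speed γ x

/-- The energy `∫ k² ds`. -/
noncomputable def curvatureEnergy (γ : ℝ → Plane) : ℝ :=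
  ∫ x in (-1 : ℝ)..1, curvature γ x ^ 2 * speed γ x

/-- Smooth regular curves `γ : [-1, 1] → ℝ²` whose ends lie on the parallel lines
`η₋ = {p | ⟨e, p⟩ = a}` and `η₊ = {p | ⟨e, p⟩ = b}` (`e` is a unit vector) and satisfy the
generalised Neumann conditions: the curve meets the lines orthogonally, and all the odd arclength
derivatives of curvature up to order `2m + 1` vanish at the ends. -/
structure IsNeumannCurve (m : ℕ) (e : Plane) (a b : ℝ) (γ : ℝ → Plane) : Prop where
  smooth : ContDiffOn ℝ ∞ γ I
  regular : ∀ x ∈ I, velocity γ x ≠ 0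
  left_mem : inner ℝ e (γ (-1)) = a
  right_mem : inner ℝ e (γ 1) = b
  -- the lines have direction `rot e`
  left_orthogonal : inner ℝ (rot e) (velocity γ (-1)) = 0
  right_orthogonal : inner ℝ (rot e) (velocity γ 1) = 0
  left_odd : ∀ j ≤ m, curvatureDeriv γ (2 * j + 1) (-1) = 0
  right_odd : ∀ j ≤ m, curvatureDeriv γ (2 * j + 1) 1 = 0

/-- `γ t x`, for `t ∈ [0, T)` and `x ∈ [-1, 1]`, is a solution of the polyharmonic curve diffusion
flow `γ_t = (-1)^(m+1) k_{s^(2m+2)} ν` with generalised Neumann boundary conditions and initial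
curve `γ 0`. It is smooth on `[-1, 1] × (0, T)`; the initial curve, itself smooth, is attained
in `C²([-1, 1])`. -/
structure IsSolution (m : ℕ) (e : Plane) (a b T : ℝ) (γ : ℝ → ℝ → Plane) : Prop where
  neumann : ∀ t ∈ Set.Ico 0 T, IsNeumannCurve m e a b (γ t)
  smooth : ContDiffOn ℝ ∞ (fun p : ℝ × ℝ => γ p.1 p.2) (Set.Ioo 0 T ×ˢ I)
  continuous_initial : ∀ i ≤ 2, ContinuousOn
    (fun p : ℝ × ℝ => iteratedDerivWithin i (γ p.1) I p.2) (Set.Ico 0 T ×ˢ I)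
  flow : ∀ t ∈ Set.Ioo 0 T, ∀ x ∈ I, HasDerivAt (fun τ => γ τ x)
    (((-1) ^ (m + 1) * curvatureDeriv (γ t) (2 * m + 2) x) • normal (γ t) x) t

end PolyFlow

/-! Write E = ∫ k² ds, L for the length, F for the normal speed and ‖·‖ for the L² norm along the
curve. Along the flow L' = -‖k_{s^{m+1}}‖² and E' = -2‖k_{s^{m+2}}‖² + (-1)^{m+1} ∫ k³ k_{s^{2m+2}}
ds. The boundary terms vanish because each pairs orders of opposite parity, and odd derivatives of k
vanish at the ends. The one missing condition, order 2m+3, follows by differentiating the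
orthogonality condition in time, which gives F_s = 0 there (`curvatureDeriv_ends`).

The reaction term is absorbed when L E is small. After m+1 integrations by parts it is a sum of
3^{m+1} integrals of k_{s^i} k_{s^j} k_{s^l} k_{s^{m+1}} with i + j + l = m + 1. Two factors are
bounded uniformly by √L ‖k_{s^{j+1}}‖ and √L ‖k_{s^{l+1}}‖, the other two by Cauchy-Schwarz. The
four norms have total order 2(m+2), and n ↦ ‖k_{s^n}‖ is log-convex, so each product is at most E
‖k_{s^{m+2}}‖² (`mul_le_of_logConvex`). Hence the reaction term is at most 3^{m+1} L E
‖k_{s^{m+2}}‖² (`abs_arcIntegral_reaction_le`).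

The uniform bounds and the Poincaré inequality need a zero of k_{s^n} for n ≤ m+1. For n > 0 the
boundary conditions and Rolle's theorem supply it; for n = 0 it comes from orthogonality to parallel
lines and smallness of L E (`exists_curvature_eq_zero`). Then E ≤ L^{2(m+2)} ‖k_{s^{m+2}}‖², so E' ≤
-L₀^{-2(m+2)} E as long as L₀ E is small, which a continuity argument makes permanent
(`curvatureEnergy_le_of_small`). -/

namespace PolyFlow

/-! ### Calculus along a fixed smooth regular curve -/

/-- The arclength integral `∫ f ds`. -/
noncomputable def arcIntegral (γ : ℝ → Plane) (f : ℝ → ℝ) : ℝ :=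
  ∫ x in (-1 : ℝ)..1, f x * speed γ x

theorem uniqueDiffOn_I : UniqueDiffOn ℝ I := uniqueDiffOn_Icc (by norm_num)

theorem left_mem_I : (-1 : ℝ) ∈ I := by simp [I]

theorem right_mem_I : (1 : ℝ) ∈ I := by simp [I]

theorem uIcc_eq_I : Set.uIcc (-1 : ℝ) 1 = I := Set.uIcc_of_le (by norm_num)

/-- A smooth regular parametrised curve on `[-1, 1]`. -/
structure IsRegularCurve (γ : ℝ → Plane) : Prop where
  smooth : ContDiffOn ℝ ∞ γ I
  regular : ∀ x ∈ I, velocity γ x ≠ 0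

theorem contDiffOn_derivWithin {F : Type*} [NormedAddCommGroup F] [NormedSpace ℝ F] {f : ℝ → F}
    (hf : ContDiffOn ℝ ∞ f I) : ContDiffOn ℝ ∞ (derivWithin f I) I :=
  hf.derivWithin uniqueDiffOn_I le_rfl

theorem smooth_mul {f g : ℝ → ℝ} (hf : ContDiffOn ℝ ∞ f I) (hg : ContDiffOn ℝ ∞ g I) :
    ContDiffOn ℝ ∞ (f * g) I := hf.mul hg

theorem smooth_add {f g : ℝ → ℝ} (hf : ContDiffOn ℝ ∞ f I) (hg : ContDiffOn ℝ ∞ g I) :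
    ContDiffOn ℝ ∞ (f + g) I := hf.add hg

theorem hasDerivWithinAt_of_smooth {F : Type*} [NormedAddCommGroup F] [NormedSpace ℝ F]
    {f : ℝ → F} (hf : ContDiffOn ℝ ∞ f I) {x : ℝ} (hx : x ∈ I) :
    HasDerivWithinAt f (derivWithin f I x) I x :=
  ((hf.differentiableOn (by simp)) x hx).hasDerivWithinAt

theorem hasDerivAt_of_smooth {F : Type*} [NormedAddCommGroup F] [NormedSpace ℝ F]
    {f : ℝ → F} (hf : ContDiffOn ℝ ∞ f I) {x : ℝ} (hx : x ∈ Set.Ioo (-1 : ℝ) 1) :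
    HasDerivAt f (derivWithin f I x) x :=
  (hasDerivWithinAt_of_smooth hf (Set.Ioo_subset_Icc_self hx)).hasDerivAt
    (Icc_mem_nhds hx.1 hx.2)

theorem intervalIntegrable_of_continuousOn {f : ℝ → ℝ} (hf : ContinuousOn f I) :
    IntervalIntegrable f MeasureTheory.volume (-1) 1 :=
  ContinuousOn.intervalIntegrable (by rwa [uIcc_eq_I])

/-- The fundamental theorem of calculus for smooth functions on `[-1, 1]`. -/
theorem integral_derivWithin {f : ℝ → ℝ} (hf : ContDiffOn ℝ ∞ f I) {a b : ℝ} (ha : a ∈ I)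
    (hb : b ∈ I) : ∫ x in a..b, derivWithin f I x = f b - f a := by
  have hsub : Set.uIcc a b ⊆ I := Set.uIcc_subset_Icc ha hb
  refine intervalIntegral.integral_eq_sub_of_hasDeriv_right (hf.continuousOn.mono hsub)
    (fun x hx => ?_) ((contDiffOn_derivWithin hf).continuousOn.mono hsub).intervalIntegrable
  refine (hasDerivAt_of_smooth hf ⟨?_, ?_⟩).hasDerivWithinAt
  · exact lt_of_le_of_lt (le_min ha.1 hb.1) hx.1
  · exact lt_of_lt_of_le hx.2 (max_le ha.2 hb.2)

namespace IsRegularCurve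

variable {γ : ℝ → Plane}

theorem smooth_velocity (hγ : IsRegularCurve γ) : ContDiffOn ℝ ∞ (velocity γ) I :=
  contDiffOn_derivWithin hγ.smooth

theorem speed_pos (hγ : IsRegularCurve γ) {x : ℝ} (hx : x ∈ I) : 0 < speed γ x :=
  norm_pos_iff.2 (hγ.regular x hx)

theorem smooth_speed (hγ : IsRegularCurve γ) : ContDiffOn ℝ ∞ (speed γ) I :=
  hγ.smooth_velocity.norm ℝ hγ.regular

theorem smooth_arcDeriv (hγ : IsRegularCurve γ) {F : Type*} [NormedAddCommGroup F]
    [NormedSpace ℝ F] {f : ℝ → F} (hf : ContDiffOn ℝ ∞ f I) : ContDiffOn ℝ ∞ (arcDeriv γ f) I :=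
  (hγ.smooth_speed.inv fun _ hx => (hγ.speed_pos hx).ne').smul (contDiffOn_derivWithin hf)

theorem smooth_iterate (hγ : IsRegularCurve γ) {f : ℝ → ℝ} (hf : ContDiffOn ℝ ∞ f I) (n : ℕ) :
    ContDiffOn ℝ ∞ ((arcDeriv γ)^[n] f) I := by
  induction n with
  | zero => exact hf
  | succ n ih => rw [Function.iterate_succ_apply']; exact hγ.smooth_arcDeriv ih

theorem smooth_tangent (hγ : IsRegularCurve γ) : ContDiffOn ℝ ∞ (tangent γ) I :=
  hγ.smooth_arcDeriv hγ.smooth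

theorem smooth_normal (hγ : IsRegularCurve γ) : ContDiffOn ℝ ∞ (normal γ) I := by
  have h := contDiffOn_euclidean.1 hγ.smooth_tangent
  refine contDiffOn_euclidean.2 fun i => ?_
  fin_cases i
  · simpa [normal, rot] using (h 1).neg
  · simpa [normal, rot] using h 0

theorem smooth_curvature (hγ : IsRegularCurve γ) : ContDiffOn ℝ ∞ (curvature γ) I :=
  (hγ.smooth_arcDeriv hγ.smooth_tangent).inner ℝ hγ.smooth_normal

theorem smooth_curvatureDeriv (hγ : IsRegularCurve γ) (n : ℕ) :
    ContDiffOn ℝ ∞ (curvatureDeriv γ n) I :=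
  hγ.smooth_iterate hγ.smooth_curvature n

theorem arcDeriv_mul_speed (hγ : IsRegularCurve γ) (f : ℝ → ℝ) {x : ℝ} (hx : x ∈ I) :
    arcDeriv γ f x * speed γ x = derivWithin f I x := by
  have := (hγ.speed_pos hx).ne'
  simp only [arcDeriv, smul_eq_mul]
  field_simp

theorem intervalIntegrable (hγ : IsRegularCurve γ) {f : ℝ → ℝ} (hf : ContinuousOn f I) :
    IntervalIntegrable (fun x => f x * speed γ x) MeasureTheory.volume (-1) 1 :=
  intervalIntegrable_of_continuousOn (hf.mul hγ.smooth_speed.continuousOn)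

end IsRegularCurve

theorem curvatureDeriv_succ (γ : ℝ → Plane) (n : ℕ) :
    curvatureDeriv γ (n + 1) = arcDeriv γ (curvatureDeriv γ n) :=
  Function.iterate_succ_apply' _ _ _

theorem arcDeriv_congr {γ : ℝ → Plane} {f g : ℝ → ℝ} (h : Set.EqOn f g I) :
    Set.EqOn (arcDeriv γ f) (arcDeriv γ g) I := fun x hx => by
  simp only [arcDeriv, derivWithin_congr h (h hx)]

theorem iterate_arcDeriv_congr {γ : ℝ → Plane} {f g : ℝ → ℝ} (h : Set.EqOn f g I) (n : ℕ) :
    Set.EqOn ((arcDeriv γ)^[n] f) ((arcDeriv γ)^[n] g) I := by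
  induction n with
  | zero => exact h
  | succ n ih => simpa only [Function.iterate_succ_apply'] using arcDeriv_congr ih

theorem arcDeriv_add {γ : ℝ → Plane} {f g : ℝ → ℝ} (hf : ContDiffOn ℝ ∞ f I)
    (hg : ContDiffOn ℝ ∞ g I) :
    Set.EqOn (arcDeriv γ (f + g)) (arcDeriv γ f + arcDeriv γ g) I := fun x hx => by
  simp only [arcDeriv, Pi.add_apply, smul_eq_mul,
    ((hasDerivWithinAt_of_smooth hf hx).add (hasDerivWithinAt_of_smooth hg hx)).derivWithin
      (uniqueDiffOn_I x hx)]
  ring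

theorem arcDeriv_mul {γ : ℝ → Plane} {f g : ℝ → ℝ} (hf : ContDiffOn ℝ ∞ f I)
    (hg : ContDiffOn ℝ ∞ g I) :
    Set.EqOn (arcDeriv γ (f * g)) (arcDeriv γ f * g + f * arcDeriv γ g) I := fun x hx => by
  simp only [arcDeriv, Pi.add_apply, Pi.mul_apply, smul_eq_mul,
    ((hasDerivWithinAt_of_smooth hf hx).mul (hasDerivWithinAt_of_smooth hg hx)).derivWithin
      (uniqueDiffOn_I x hx)]
  ring

theorem iterate_arcDeriv_add {γ : ℝ → Plane} (hγ : IsRegularCurve γ) {f g : ℝ → ℝ}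
    (hf : ContDiffOn ℝ ∞ f I) (hg : ContDiffOn ℝ ∞ g I) (n : ℕ) :
    Set.EqOn ((arcDeriv γ)^[n] (f + g)) ((arcDeriv γ)^[n] f + (arcDeriv γ)^[n] g) I := by
  induction n with
  | zero => exact fun _ _ => rfl
  | succ n ih =>
    simp only [Function.iterate_succ_apply']
    exact (arcDeriv_congr ih).trans
      (arcDeriv_add (hγ.smooth_iterate hf n) (hγ.smooth_iterate hg n))

/-! ### Arclength integrals -/

namespace IsRegularCurve

variable {γ : ℝ → Plane}

theorem arcIntegral_congr {f g : ℝ → ℝ} (h : Set.EqOn f g I) :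
    arcIntegral γ f = arcIntegral γ g := by
  refine intervalIntegral.integral_congr fun x hx => ?_
  rw [uIcc_eq_I] at hx
  simp only [h hx]

theorem arcIntegral_add (hγ : IsRegularCurve γ) {f g : ℝ → ℝ} (hf : ContinuousOn f I)
    (hg : ContinuousOn g I) : arcIntegral γ (f + g) = arcIntegral γ f + arcIntegral γ g := by
  simp only [arcIntegral, Pi.add_apply, add_mul]
  exact intervalIntegral.integral_add (hγ.intervalIntegrable hf) (hγ.intervalIntegrable hg)

theorem arcIntegral_const_mul (c : ℝ) (f : ℝ → ℝ) :
    arcIntegral γ (fun x => c * f x) = c * arcIntegral γ f := by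
  simp only [arcIntegral, mul_assoc]
  exact intervalIntegral.integral_const_mul _ _

theorem arcIntegral_mono (hγ : IsRegularCurve γ) {f g : ℝ → ℝ} (hf : ContinuousOn f I)
    (hg : ContinuousOn g I) (h : ∀ x ∈ I, f x ≤ g x) : arcIntegral γ f ≤ arcIntegral γ g :=
  intervalIntegral.integral_mono_on (by norm_num) (hγ.intervalIntegrable hf)
    (hγ.intervalIntegrable hg) fun x hx => mul_le_mul_of_nonneg_right (h x hx) (norm_nonneg _)

theorem arcIntegral_nonneg {f : ℝ → ℝ} (h : ∀ x ∈ I, 0 ≤ f x) : 0 ≤ arcIntegral γ f :=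
  intervalIntegral.integral_nonneg (by norm_num) fun x hx => mul_nonneg (h x hx) (norm_nonneg _)

theorem abs_arcIntegral_le (f : ℝ → ℝ) :
    |arcIntegral γ f| ≤ arcIntegral γ fun x => |f x| := by
  refine (intervalIntegral.abs_integral_le_integral_abs (by norm_num)).trans_eq ?_
  simp [arcIntegral, abs_mul, speed]

theorem arcIntegral_one : (arcIntegral γ fun _ => 1) = length γ := by
  simp [arcIntegral, length]

theorem length_pos (hγ : IsRegularCurve γ) : 0 < length γ :=
  intervalIntegral.intervalIntegral_pos_of_pos_on
    (intervalIntegrable_of_continuousOn hγ.smooth_speed.continuousOn)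
    (fun _ hx => hγ.speed_pos (Set.Ioo_subset_Icc_self hx)) (by norm_num)

/-- Integration by parts along a curve. -/
theorem arcIntegral_mul_arcDeriv (hγ : IsRegularCurve γ) {f g : ℝ → ℝ}
    (hf : ContDiffOn ℝ ∞ f I) (hg : ContDiffOn ℝ ∞ g I) (hl : f (-1) * g (-1) = 0)
    (hr : f 1 * g 1 = 0) :
    arcIntegral γ (f * arcDeriv γ g) = - arcIntegral γ (arcDeriv γ f * g) := by
  have hD := hγ.arcIntegral_add (hγ.smooth_arcDeriv hf |>.mul hg).continuousOn
    (hf.mul (hγ.smooth_arcDeriv hg)).continuousOn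
  have h0 : arcIntegral γ (arcDeriv γ (f * g)) = 0 := by
    rw [arcIntegral, intervalIntegral.integral_congr (g := derivWithin (f * g) I),
      integral_derivWithin (f := f * g) (hf.mul hg) left_mem_I right_mem_I]
    · simp [hl, hr]
    · intro x hx
      rw [uIcc_eq_I] at hx
      exact hγ.arcDeriv_mul_speed _ hx
  rw [arcIntegral_congr (arcDeriv_mul hf hg)] at h0
  exact eq_neg_of_add_eq_zero_right (hD.symm.trans h0)

/-- Repeated integration by parts along a curve. -/
theorem arcIntegral_mul_curvatureDeriv (hγ : IsRegularCurve γ) {f : ℝ → ℝ}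
    (hf : ContDiffOn ℝ ∞ f I) (p n : ℕ)
    (hl : ∀ i < n, (arcDeriv γ)^[i] f (-1) * curvatureDeriv γ (p + (n - 1 - i)) (-1) = 0)
    (hr : ∀ i < n, (arcDeriv γ)^[i] f 1 * curvatureDeriv γ (p + (n - 1 - i)) 1 = 0) :
    arcIntegral γ (f * curvatureDeriv γ (p + n)) =
      (-1) ^ n * arcIntegral γ ((arcDeriv γ)^[n] f * curvatureDeriv γ p) := by
  induction n generalizing f with
  | zero => simp
  | succ n ih =>
    -- The boundary term numbered i + 1 for `f` is the one numbered i for `arcDeriv γ f`.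
    have hshift : ∀ i, n + 1 - 1 - (i + 1) = n - 1 - i := fun i => by omega
    rw [← add_assoc, curvatureDeriv_succ, hγ.arcIntegral_mul_arcDeriv hf
      (hγ.smooth_curvatureDeriv _) (by simpa using hl 0 (by omega))
      (by simpa using hr 0 (by omega)), ih (hγ.smooth_arcDeriv hf)
      (fun i hi => by rw [← hshift]; exact hl (i + 1) (by omega))
      (fun i hi => by rw [← hshift]; exact hr (i + 1) (by omega)), pow_succ,
      Function.iterate_succ_apply]
    ring

/-- The Cauchy-Schwarz inequality for arclength integrals. -/
theorem arcIntegral_mul_le (hγ : IsRegularCurve γ) {f g : ℝ → ℝ} (hf : ContinuousOn f I)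
    (hg : ContinuousOn g I) :
    arcIntegral γ (fun x => |f x| * |g x|) ≤
      √(arcIntegral γ fun x => f x ^ 2) * √(arcIntegral γ fun x => g x ^ 2) := by
  set A := arcIntegral γ fun x => f x ^ 2
  set B := arcIntegral γ fun x => |f x| * |g x|
  set C := arcIntegral γ fun x => g x ^ 2
  have hC : 0 ≤ C := arcIntegral_nonneg fun x _ => sq_nonneg _
  have hB : 0 ≤ B := arcIntegral_nonneg fun x _ => by positivity
  -- The integral of (y|g| - |f|)² is a nonnegative quadratic in y, so its discriminant is at most
  -- zero.
  have key : ∀ y : ℝ, 0 ≤ C * (y * y) + (-2 * B) * y + A := fun y => by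
    have h0 : 0 ≤ arcIntegral γ fun x => (y * |g x| - |f x|) ^ 2 :=
      arcIntegral_nonneg fun x _ => sq_nonneg _
    have h1 : (arcIntegral γ fun x => (y * |g x| - |f x|) ^ 2) =
        arcIntegral γ ((fun x => y ^ 2 * g x ^ 2) + ((fun x => (-2 * y) * (|f x| * |g x|)) +
          fun x => f x ^ 2)) := by
      refine arcIntegral_congr fun x _ => ?_
      simp only [Pi.add_apply, ← sq_abs (f x), ← sq_abs (g x)]
      ring
    rw [h1, hγ.arcIntegral_add (by fun_prop) (by fun_prop),
      hγ.arcIntegral_add (by fun_prop) (by fun_prop), arcIntegral_const_mul,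
      arcIntegral_const_mul] at h0
    linarith
  have h := discrim_le_zero key
  rw [discrim] at h
  rw [← Real.sqrt_mul' _ hC]
  exact Real.le_sqrt_of_sq_le (by linarith)

/-- A function with a zero is bounded by the square root of the length times the `L²` norm of its
arclength derivative. -/
theorem abs_le_of_zero (hγ : IsRegularCurve γ) {f : ℝ → ℝ} (hf : ContDiffOn ℝ ∞ f I)
    {c x : ℝ} (hc : c ∈ I) (hfc : f c = 0) (hx : x ∈ I) :
    |f x| ≤ √(length γ) * √(arcIntegral γ fun x => arcDeriv γ f x ^ 2) := by
  -- The integral of |f'| from c to x is enlarged to all of [-1, 1]. The factor |1| prepares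
  -- Cauchy-Schwarz against the constant 1, whose L² norm is √L.
  have h1 : |f x| ≤ arcIntegral γ fun x => |1| * |arcDeriv γ f x| := by
    have h2 := integral_derivWithin hf hc hx
    rw [hfc, sub_zero] at h2
    have hi : IntervalIntegrable (fun y => |derivWithin f I y|) MeasureTheory.volume (-1) 1 :=
      intervalIntegrable_of_continuousOn (contDiffOn_derivWithin hf).continuousOn.abs
    have h3 : (∫ y in (-1 : ℝ)..1, |derivWithin f I y|) =
        arcIntegral γ fun x => |1| * |arcDeriv γ f x| := by
      refine intervalIntegral.integral_congr fun y hy => ?_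
      rw [uIcc_eq_I] at hy
      simp only [← hγ.arcDeriv_mul_speed f hy, abs_mul, abs_of_pos (hγ.speed_pos hy), abs_one,
        one_mul]
    rw [← h2, ← h3]
    have h4 := intervalIntegral.norm_integral_le_abs_integral_norm (μ := MeasureTheory.volume)
      (f := derivWithin f I) (a := c) (b := x)
    refine h4.trans ?_
    rw [← abs_of_nonneg (intervalIntegral.integral_nonneg (μ := MeasureTheory.volume)
      (a := -1) (b := 1) (by norm_num) fun y _ => abs_nonneg (derivWithin f I y))]
    refine intervalIntegral.abs_integral_mono_interval ?_
      (Filter.Eventually.of_forall fun _ => abs_nonneg _) hi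
    rw [Set.uIoc_of_le (show (-1 : ℝ) ≤ 1 by norm_num)]
    refine Set.Ioc_subset_Ioc (le_min hc.1 hx.1) (max_le hc.2 hx.2)
  refine (h1.trans (hγ.arcIntegral_mul_le (f := fun _ => 1) continuousOn_const
    (hγ.smooth_arcDeriv hf).continuousOn)).trans_eq ?_
  simp only [one_pow, arcIntegral_one]

end IsRegularCurve
/-! ### The Frenet equations -/

namespace IsRegularCurve

variable {γ : ℝ → Plane}

theorem norm_tangent (hγ : IsRegularCurve γ) {x : ℝ} (hx : x ∈ I) : ‖tangent γ x‖ = 1 := by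
  have h := (hγ.speed_pos hx).ne'
  change ‖(speed γ x)⁻¹ • velocity γ x‖ = 1
  rw [norm_smul, norm_inv, speed, norm_norm, ← speed, inv_mul_cancel₀ h]

theorem tangent_sq (hγ : IsRegularCurve γ) {x : ℝ} (hx : x ∈ I) :
    tangent γ x 0 ^ 2 + tangent γ x 1 ^ 2 = 1 := by
  have h := EuclideanSpace.norm_sq_eq (tangent γ x)
  simpa [hγ.norm_tangent hx] using h.symm

theorem smooth_tangent_apply (hγ : IsRegularCurve γ) (i : Fin 2) :
    ContDiffOn ℝ ∞ (fun x => tangent γ x i) I :=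
  contDiffOn_euclidean.1 hγ.smooth_tangent i

theorem derivWithin_apply {f : ℝ → Plane} (hf : ContDiffOn ℝ ∞ f I) (i : Fin 2) {x : ℝ}
    (hx : x ∈ I) : derivWithin (fun y => f y i) I x = derivWithin f I x i :=
  ((EuclideanSpace.proj (𝕜 := ℝ) i).hasFDerivAt.comp_hasDerivWithinAt x
    (hasDerivWithinAt_of_smooth hf hx)).derivWithin (uniqueDiffOn_I x hx)

/-- The product k|γ_x| is the x-derivative of the tangent angle, here τ × τ_x. Being free of
division by the speed, it is the form best suited to differentiation in time. -/
theorem curvature_mul_speed (hγ : IsRegularCurve γ) {x : ℝ} (hx : x ∈ I) :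
    curvature γ x * speed γ x =
      tangent γ x 0 * derivWithin (fun y => tangent γ y 1) I x -
        tangent γ x 1 * derivWithin (fun y => tangent γ y 0) I x := by
  have h := (hγ.speed_pos hx).ne'
  rw [derivWithin_apply hγ.smooth_tangent _ hx, derivWithin_apply hγ.smooth_tangent _ hx]
  simp only [curvature, normal, rot, arcDeriv, PiLp.inner_apply, Fin.sum_univ_two]
  simp
  field_simp
  ring

theorem tangent_orthogonal (hγ : IsRegularCurve γ) {x : ℝ} (hx : x ∈ I) :
    tangent γ x 0 * derivWithin (fun y => tangent γ y 0) I x +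
      tangent γ x 1 * derivWithin (fun y => tangent γ y 1) I x = 0 := by
  have h0 := hasDerivWithinAt_of_smooth (hγ.smooth_tangent_apply 0) hx
  have h1 := hasDerivWithinAt_of_smooth (hγ.smooth_tangent_apply 1) hx
  have h2 := ((h0.pow 2).add (h1.pow 2)).derivWithin (uniqueDiffOn_I x hx)
  have h3 : derivWithin (fun y => tangent γ y 0 ^ 2 + tangent γ y 1 ^ 2) I x = 0 := by
    rw [derivWithin_congr (f := fun _ => (1 : ℝ)) (fun y hy => hγ.tangent_sq hy)
      (hγ.tangent_sq hx)]
    simp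
  replace h2 := h3.symm.trans h2
  simp at h2
  linarith

/-- The components of τ_x along τ and ν are known from `tangent_orthogonal` and
`curvature_mul_speed`. Solving this linear system, of determinant |τ|² = 1, gives τ_s = kν in
coordinates. -/
theorem derivWithin_tangent_zero (hγ : IsRegularCurve γ) {x : ℝ} (hx : x ∈ I) :
    derivWithin (fun y => tangent γ y 0) I x = -(curvature γ x * speed γ x * tangent γ x 1) := by
  rw [hγ.curvature_mul_speed hx]
  linear_combination -derivWithin (fun y => tangent γ y 0) I x * hγ.tangent_sq hx +
    tangent γ x 0 * hγ.tangent_orthogonal hx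

theorem derivWithin_tangent_one (hγ : IsRegularCurve γ) {x : ℝ} (hx : x ∈ I) :
    derivWithin (fun y => tangent γ y 1) I x = curvature γ x * speed γ x * tangent γ x 0 := by
  rw [hγ.curvature_mul_speed hx]
  linear_combination -derivWithin (fun y => tangent γ y 1) I x * hγ.tangent_sq hx +
    tangent γ x 1 * hγ.tangent_orthogonal hx

/-- Leibniz rule applied to the innermost derivative. It preserves the total order n + i + j + l, so
statements about derivatives of k³ can be proved by induction on n for all cubic monomials at once.
-/
theorem iterate_cubic_succ (hγ : IsRegularCurve γ) (n i j l : ℕ) {x : ℝ} (hx : x ∈ I) :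
    (arcDeriv γ)^[n + 1] (curvatureDeriv γ i * curvatureDeriv γ j * curvatureDeriv γ l) x =
      (arcDeriv γ)^[n] (curvatureDeriv γ (i + 1) * curvatureDeriv γ j * curvatureDeriv γ l) x +
      (arcDeriv γ)^[n] (curvatureDeriv γ i * curvatureDeriv γ (j + 1) * curvatureDeriv γ l) x +
      (arcDeriv γ)^[n] (curvatureDeriv γ i * curvatureDeriv γ j * curvatureDeriv γ (l + 1)) x := by
  have hk := fun n => hγ.smooth_curvatureDeriv n
  have h1 : Set.EqOn
      (arcDeriv γ (curvatureDeriv γ i * curvatureDeriv γ j * curvatureDeriv γ l))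
      (curvatureDeriv γ (i + 1) * curvatureDeriv γ j * curvatureDeriv γ l +
        curvatureDeriv γ i * curvatureDeriv γ (j + 1) * curvatureDeriv γ l +
        curvatureDeriv γ i * curvatureDeriv γ j * curvatureDeriv γ (l + 1)) I := fun y hy => by
    simp only [arcDeriv_mul (smooth_mul (hk i) (hk j)) (hk l) hy, Pi.add_apply, Pi.mul_apply,
      arcDeriv_mul (hk i) (hk j) hy, curvatureDeriv_succ]
    ring
  have hs := fun i j l => smooth_mul (smooth_mul (hk i) (hk j)) (hk l)
  rw [Function.iterate_succ_apply, iterate_arcDeriv_congr h1 n hx,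
    iterate_arcDeriv_add hγ (smooth_add (hs _ _ _) (hs _ _ _)) (hs _ _ _) n hx, Pi.add_apply,
    iterate_arcDeriv_add hγ (hs _ _ _) (hs _ _ _) n hx, Pi.add_apply]

end IsRegularCurve

/-! ### Interpolation for log-convex sequences -/

/-- A product of four terms of a log-convex sequence is bounded by the product of the extreme terms
with the same total index. -/
theorem mul_le_of_logConvex {M : ℕ → ℝ} {N : ℕ} (hN : 0 < N) (hpos : ∀ n ≤ N, 0 < M n)
    (hlc : ∀ n, n + 1 < N → M (n + 1) ^ 2 ≤ M n * M (n + 2)) {a b c d : ℕ} (ha : a ≤ N)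
    (hb : b ≤ N) (hc : c ≤ N) (hd : d ≤ N) (hsum : a + b + c + d = 2 * N) :
    M a * M b * M c * M d ≤ M 0 ^ 2 * M N ^ 2 := by
  -- The normalised logarithm is convex with value 0 at 0, so it lies below its chord from 0 to N.
  set u : ℕ → ℝ := fun n => Real.log (M n) - Real.log (M 0) with hu
  have hu0 : u 0 = 0 := by simp [hu]
  have hconv : ∀ n, n + 1 < N → 2 * u (n + 1) ≤ u n + u (n + 2) := fun n hn => by
    have h := Real.log_le_log (pow_pos (hpos (n + 1) hn.le) 2) (hlc n hn)
    rw [Real.log_pow, Real.log_mul (hpos n (by omega)).ne' (hpos (n + 2) hn).ne'] at h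
    simp only [hu]
    push_cast at h
    linarith
  -- The slopes u n / n are nondecreasing, stated without division to include n = 0.
  have hstep : ∀ n, n < N → (n + 1) * u n ≤ n * u (n + 1) := fun n => by
    induction n with
    | zero => simp [hu0]
    | succ n ih =>
      intro hn
      have h1 := ih (by omega)
      have h2 := mul_le_mul_of_nonneg_left (hconv n hn) (by positivity : (0 : ℝ) ≤ n + 1)
      push_cast
      linarith
  -- The chord bound, by descending induction from N.
  have hbound : ∀ k n, n + k = N → (N : ℝ) * u n ≤ n * u N := fun k => by
    induction k with
    | zero => intro n hn; simp at hn; subst hn; exact le_rfl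
    | succ k ih =>
      intro n hn
      have h1 := ih (n + 1) (by omega)
      have h2 := hstep n (by omega)
      push_cast at h1
      have h3 : ((n : ℝ) + 1) * (N * u n) ≤ (n + 1) * (n * u N) := by
        nlinarith [mul_le_mul_of_nonneg_left h2 (Nat.cast_nonneg (α := ℝ) N),
          mul_le_mul_of_nonneg_left h1 (Nat.cast_nonneg (α := ℝ) n)]
      exact le_of_mul_le_mul_left h3 (by positivity)
  have hb' : ∀ n ≤ N, (N : ℝ) * u n ≤ n * u N := fun n hn => hbound (N - n) n (by omega)
  have hs : (a : ℝ) + b + c + d = 2 * N := by exact_mod_cast hsum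
  have hN' : (0 : ℝ) < N := by exact_mod_cast hN
  have htot : u a + u b + u c + u d ≤ 2 * u N := by
    refine le_of_mul_le_mul_left ?_ hN'
    have e : (a : ℝ) * u N + b * u N + c * u N + d * u N = 2 * N * u N := by rw [← hs]; ring
    linarith [hb' a ha, hb' b hb, hb' c hc, hb' d hd]
  have h0 := hpos 0 (Nat.zero_le N)
  have hNp := hpos N le_rfl
  have hA := hpos a ha
  have hB := hpos b hb
  have hC := hpos c hc
  have hD := hpos d hd
  rw [← Real.log_le_log_iff (by positivity) (by positivity), Real.log_mul (by positivity) hD.ne',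
    Real.log_mul (by positivity) hC.ne', Real.log_mul hA.ne' hB.ne',
    Real.log_mul (by positivity) (by positivity), Real.log_pow, Real.log_pow]
  simp only [hu] at htot
  push_cast
  linarith

/-! ### Estimates for curves with generalised Neumann conditions -/

/-- The `L²` norm of the `n`-th arclength derivative of curvature. -/
noncomputable def curvatureNorm (γ : ℝ → Plane) (n : ℕ) : ℝ :=
  √(arcIntegral γ fun x => curvatureDeriv γ n x ^ 2)

theorem curvatureNorm_nonneg (γ : ℝ → Plane) (n : ℕ) : 0 ≤ curvatureNorm γ n := Real.sqrt_nonneg _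

theorem curvatureNorm_sq (γ : ℝ → Plane) (n : ℕ) :
    curvatureNorm γ n ^ 2 = arcIntegral γ fun x => curvatureDeriv γ n x ^ 2 :=
  Real.sq_sqrt (IsRegularCurve.arcIntegral_nonneg fun _ _ => sq_nonneg _)

theorem curvatureNorm_zero_sq (γ : ℝ → Plane) : curvatureNorm γ 0 ^ 2 = curvatureEnergy γ :=
  curvatureNorm_sq γ 0

namespace IsNeumannCurve

variable {m : ℕ} {e : Plane} {a b : ℝ} {γ : ℝ → Plane}

theorem isRegularCurve (h : IsNeumannCurve m e a b γ) : IsRegularCurve γ :=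
  ⟨h.smooth, h.regular⟩

theorem odd_deriv_eq_zero (h : IsNeumannCurve m e a b γ) {n : ℕ} (hn : Odd n)
    (hle : n ≤ 2 * m + 1) : curvatureDeriv γ n (-1) = 0 ∧ curvatureDeriv γ n 1 = 0 := by
  obtain ⟨j, rfl⟩ := hn
  exact ⟨h.left_odd j (by omega), h.right_odd j (by omega)⟩

/-- One of the two orders is odd and its derivative vanishes at the ends. Allowing j = 2m + 2 costs
nothing, since that order is even. -/
theorem mul_deriv_eq_zero (h : IsNeumannCurve m e a b γ) {i j : ℕ} (hij : Odd (i + j))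
    (hi : i ≤ 2 * m + 1) (hj : j ≤ 2 * m + 2) :
    curvatureDeriv γ i (-1) * curvatureDeriv γ j (-1) = 0 ∧
      curvatureDeriv γ i 1 * curvatureDeriv γ j 1 = 0 := by
  rcases Nat.even_or_odd i with hi' | hi'
  · have := h.odd_deriv_eq_zero (n := j) (by grind) (by grind)
    simp [this]
  · have := h.odd_deriv_eq_zero hi' hi
    simp [this]

/-- `⟨rot e, τ⟩` vanishes at the ends. -/
theorem tangent_ends (h : IsNeumannCurve m e a b γ) :
    (e 0 * tangent γ (-1) 1 - e 1 * tangent γ (-1) 0 = 0) ∧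
      e 0 * tangent γ 1 1 - e 1 * tangent γ 1 0 = 0 := by
  have hl := h.left_orthogonal
  have hr := h.right_orthogonal
  simp [rot, PiLp.inner_apply, Fin.sum_univ_two] at hl hr
  have e1 : ∀ x i, tangent γ x i = (speed γ x)⁻¹ * velocity γ x i := fun x i => rfl
  simp only [e1]
  constructor
  · linear_combination (speed γ (-1))⁻¹ * hl
  · linear_combination (speed γ 1)⁻¹ * hr

theorem integral_abs_curvature_le (h : IsNeumannCurve m e a b γ) :
    (arcIntegral γ fun x => |curvature γ x|) ≤ √(length γ * curvatureEnergy γ) := by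
  have := h.isRegularCurve.arcIntegral_mul_le (f := fun _ => 1) continuousOn_const
    h.isRegularCurve.smooth_curvature.continuousOn
  rw [Real.sqrt_mul h.isRegularCurve.length_pos.le]
  simp only [abs_one, one_mul, one_pow, IsRegularCurve.arcIntegral_one] at this
  exact this

/-- If `L ∫ k² ds < 1`, the curvature has a zero. -/
theorem exists_curvature_eq_zero (h : IsNeumannCurve m e a b γ) (he : ‖e‖ = 1)
    (hsmall : length γ * curvatureEnergy γ < 1) : ∃ c ∈ I, curvature γ c = 0 := by
  have hγ := h.isRegularCurve
  have he2 : e 0 ^ 2 + e 1 ^ 2 = 1 := by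
    have h := EuclideanSpace.norm_sq_eq e
    simpa [he] using h.symm
  have hT0 := hγ.smooth_tangent_apply 0
  have hT1 := hγ.smooth_tangent_apply 1
  have hf : ContDiffOn ℝ ∞ (fun x => e 0 * tangent γ x 1 - e 1 * tangent γ x 0) I :=
    (contDiffOn_const.mul hT1).sub (contDiffOn_const.mul hT0)
  have hg : ContDiffOn ℝ ∞ (fun x => e 0 * tangent γ x 0 + e 1 * tangent γ x 1) I :=
    (contDiffOn_const.mul hT0).add (contDiffOn_const.mul hT1)
  -- Rolle's theorem for ⟨rot e, τ⟩, whose x-derivative is k ⟨e, τ⟩ |γ_x|. It remains to exclude ⟨e,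
  -- τ⟩ = 0 at c.
  obtain ⟨c, hc, hc0⟩ := exists_deriv_eq_zero (by norm_num : (-1 : ℝ) < 1) hf.continuousOn
    (h.tangent_ends.1.trans h.tangent_ends.2.symm)
  have hcI : c ∈ I := Set.Ioo_subset_Icc_self hc
  refine ⟨c, hcI, ?_⟩
  have hf' : ∀ x ∈ I, HasDerivWithinAt (fun x => e 0 * tangent γ x 1 - e 1 * tangent γ x 0)
      (curvature γ x * speed γ x * (e 0 * tangent γ x 0 + e 1 * tangent γ x 1)) I x :=
    fun x hx => by
      have h0 := hasDerivWithinAt_of_smooth hT0 hx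
      have h1 := hasDerivWithinAt_of_smooth hT1 hx
      rw [hγ.derivWithin_tangent_zero hx] at h0
      rw [hγ.derivWithin_tangent_one hx] at h1
      exact ((h1.const_mul (e 0)).sub (h0.const_mul (e 1))).congr_deriv (by ring)
  have hg' : ∀ x ∈ I, derivWithin (fun x => e 0 * tangent γ x 0 + e 1 * tangent γ x 1) I x =
      -(curvature γ x * (e 0 * tangent γ x 1 - e 1 * tangent γ x 0)) * speed γ x :=
    fun x hx => by
      have h0 := hasDerivWithinAt_of_smooth hT0 hx
      have h1 := hasDerivWithinAt_of_smooth hT1 hx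
      rw [hγ.derivWithin_tangent_zero hx] at h0
      rw [hγ.derivWithin_tangent_one hx] at h1
      exact (((h0.const_mul (e 0)).add (h1.const_mul (e 1))).congr_deriv (by ring)).derivWithin
        (uniqueDiffOn_I x hx)
  have hpyth : ∀ x ∈ I, (e 0 * tangent γ x 0 + e 1 * tangent γ x 1) ^ 2 +
      (e 0 * tangent γ x 1 - e 1 * tangent γ x 0) ^ 2 = 1 := fun x hx => by
    linear_combination (tangent γ x 0 ^ 2 + tangent γ x 1 ^ 2) * he2 + hγ.tangent_sq hx
  -- The arclength derivative of ⟨e, τ⟩ is -k ⟨rot e, τ⟩, at most |k| in modulus, so ⟨e, τ⟩ varies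
  -- by at most ∫ |k| ds ≤ √(L E) < 1.
  have hdev : |(e 0 * tangent γ c 0 + e 1 * tangent γ c 1) -
      (e 0 * tangent γ (-1) 0 + e 1 * tangent γ (-1) 1)| < 1 := by
    rw [← integral_derivWithin hg left_mem_I hcI, ← Real.norm_eq_abs]
    calc _ ≤ ∫ x in (-1 : ℝ)..c, |curvature γ x| * speed γ x := by
          refine intervalIntegral.norm_integral_le_of_norm_le hc.1.le (Filter.Eventually.of_forall
            fun x hx => ?_) ((hγ.intervalIntegrable
              hγ.smooth_curvature.continuousOn.abs).mono_set ?_)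
          · have hxI : x ∈ I := ⟨hx.1.le, hx.2.trans hc.2.le⟩
            rw [hg' x hxI, Real.norm_eq_abs, abs_mul, abs_neg, abs_mul,
              abs_of_pos (hγ.speed_pos hxI)]
            refine mul_le_mul_of_nonneg_right (mul_le_of_le_one_right (abs_nonneg _) ?_)
              (hγ.speed_pos hxI).le
            rw [abs_le_one_iff_mul_self_le_one]
            nlinarith [hpyth x hxI, sq_nonneg (e 0 * tangent γ x 0 + e 1 * tangent γ x 1)]
          · rw [uIcc_eq_I, Set.uIcc_of_le hc.1.le]
            exact Set.Icc_subset_Icc_right hc.2.le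
      _ ≤ arcIntegral γ fun x => |curvature γ x| := by
          refine intervalIntegral.integral_mono_interval le_rfl hc.1.le hc.2.le
            (Filter.Eventually.of_forall fun x => mul_nonneg (abs_nonneg _) (norm_nonneg _))
            (hγ.intervalIntegrable hγ.smooth_curvature.continuousOn.abs)
      _ ≤ √(length γ * curvatureEnergy γ) := h.integral_abs_curvature_le
      _ < 1 := by rw [Real.sqrt_lt' one_pos]; simpa using hsmall
  -- At the left end ⟨e, τ⟩ = ±1, so a variation below 1 cannot bring it to 0.
  have hne : e 0 * tangent γ c 0 + e 1 * tangent γ c 1 ≠ 0 := fun h0 => by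
    have h1 := hpyth (-1) left_mem_I
    rw [h.tangent_ends.1] at h1
    rw [h0, zero_sub, abs_neg, ← sq_lt_one_iff_abs_lt_one] at hdev
    linarith
  rw [((hf' c hcI).hasDerivAt (Icc_mem_nhds hc.1 hc.2)).deriv] at hc0
  exact (mul_eq_zero.1 ((mul_eq_zero.1 hc0).resolve_right hne)).resolve_right
    (hγ.speed_pos hcI).ne'

/-- Odd orders vanish at the ends; a positive even order is the derivative of an odd one, so Rolle's
theorem applies; order 0 is `exists_curvature_eq_zero`. -/
theorem exists_curvatureDeriv_eq_zero (h : IsNeumannCurve m e a b γ) (he : ‖e‖ = 1)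
    (hsmall : length γ * curvatureEnergy γ < 1) {n : ℕ} (hn : n ≤ m + 1) :
    ∃ c ∈ I, curvatureDeriv γ n c = 0 := by
  have hγ := h.isRegularCurve
  rcases Nat.even_or_odd n with hev | hodd
  · rcases n with _ | n
    · exact h.exists_curvature_eq_zero he hsmall
    · have h0 := h.odd_deriv_eq_zero (n := n) (by grind) (by omega)
      obtain ⟨c, hc, hc0⟩ := exists_deriv_eq_zero (by norm_num : (-1 : ℝ) < 1)
        (hγ.smooth_curvatureDeriv n).continuousOn (h0.1.trans h0.2.symm)
      rw [(hasDerivAt_of_smooth (hγ.smooth_curvatureDeriv n) hc).deriv] at hc0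
      refine ⟨c, Set.Ioo_subset_Icc_self hc, ?_⟩
      rw [curvatureDeriv_succ, arcDeriv, hc0, smul_zero]
  · exact ⟨-1, left_mem_I, (h.odd_deriv_eq_zero hodd (by omega)).1⟩

theorem abs_curvatureDeriv_le (h : IsNeumannCurve m e a b γ) (he : ‖e‖ = 1)
    (hsmall : length γ * curvatureEnergy γ < 1) {n : ℕ} (hn : n ≤ m + 1) {x : ℝ} (hx : x ∈ I) :
    |curvatureDeriv γ n x| ≤ √(length γ) * curvatureNorm γ (n + 1) := by
  obtain ⟨c, hc, hc0⟩ := h.exists_curvatureDeriv_eq_zero he hsmall hn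
  have := h.isRegularCurve.abs_le_of_zero (h.isRegularCurve.smooth_curvatureDeriv n) hc hc0 hx
  rwa [← curvatureDeriv_succ] at this

/-- Poincaré inequality. -/
theorem curvatureNorm_le (h : IsNeumannCurve m e a b γ) (he : ‖e‖ = 1)
    (hsmall : length γ * curvatureEnergy γ < 1) {n : ℕ} (hn : n ≤ m + 1) :
    curvatureNorm γ n ≤ length γ * curvatureNorm γ (n + 1) := by
  have hγ := h.isRegularCurve
  have hL := hγ.length_pos
  refine Real.sqrt_le_iff.2 ⟨mul_nonneg hL.le (curvatureNorm_nonneg _ _), ?_⟩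
  refine (hγ.arcIntegral_mono (g := fun _ => (length γ * curvatureNorm γ (n + 1) ^ 2) * 1)
    ((hγ.smooth_curvatureDeriv n).continuousOn.pow 2) continuousOn_const fun x hx => ?_).trans_eq ?_
  · have h1 := pow_le_pow_left₀ (abs_nonneg _) (h.abs_curvatureDeriv_le he hsmall hn hx) 2
    rwa [sq_abs, mul_pow, Real.sq_sqrt hL.le, ← mul_one (length γ * _)] at h1
  · rw [IsRegularCurve.arcIntegral_const_mul, IsRegularCurve.arcIntegral_one]
    ring

theorem curvatureNorm_zero_le (h : IsNeumannCurve m e a b γ) (he : ‖e‖ = 1)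
    (hsmall : length γ * curvatureEnergy γ < 1) {n : ℕ} (hn : n ≤ m + 2) :
    curvatureNorm γ 0 ≤ length γ ^ n * curvatureNorm γ n := by
  induction n with
  | zero => simp
  | succ n ih =>
    refine (ih (by omega)).trans ?_
    rw [pow_succ, mul_assoc]
    exact mul_le_mul_of_nonneg_left (h.curvatureNorm_le he hsmall (by omega))
      (pow_nonneg h.isRegularCurve.length_pos.le _)

theorem curvatureEnergy_le (h : IsNeumannCurve m e a b γ) (he : ‖e‖ = 1)
    (hsmall : length γ * curvatureEnergy γ < 1) :
    curvatureEnergy γ ≤ length γ ^ (2 * (m + 2)) * curvatureNorm γ (m + 2) ^ 2 := by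
  rw [← curvatureNorm_zero_sq, mul_comm 2, pow_mul, ← mul_pow]
  exact pow_le_pow_left₀ (curvatureNorm_nonneg _ _) (h.curvatureNorm_zero_le he hsmall le_rfl) 2

/-- Integrate the square of k_{s^{n+1}} by parts and apply Cauchy-Schwarz. The boundary terms pair
consecutive orders, one of which is odd. -/
theorem curvatureNorm_logConvex (h : IsNeumannCurve m e a b γ) {n : ℕ} (hn : n + 1 < m + 2) :
    curvatureNorm γ (n + 1) ^ 2 ≤ curvatureNorm γ n * curvatureNorm γ (n + 2) := by
  have hγ := h.isRegularCurve
  have hb := h.mul_deriv_eq_zero (i := n + 1) (j := n) (by grind) (by omega) (by omega)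
  have hp := hγ.arcIntegral_mul_arcDeriv (hγ.smooth_curvatureDeriv (n + 1))
    (hγ.smooth_curvatureDeriv n) hb.1 hb.2
  rw [← curvatureDeriv_succ, ← curvatureDeriv_succ] at hp
  rw [curvatureNorm_sq]
  calc _ = arcIntegral γ (curvatureDeriv γ (n + 1) * curvatureDeriv γ (n + 1)) :=
        IsRegularCurve.arcIntegral_congr fun x _ => by simp [sq]
    _ ≤ |arcIntegral γ (curvatureDeriv γ (n + 2) * curvatureDeriv γ n)| := by
        rw [hp]; exact neg_le_abs _
    _ ≤ arcIntegral γ fun x => |curvatureDeriv γ n x| * |curvatureDeriv γ (n + 2) x| := by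
        refine (IsRegularCurve.abs_arcIntegral_le _).trans_eq ?_
        simp [abs_mul, mul_comm]
    _ ≤ _ := hγ.arcIntegral_mul_le (hγ.smooth_curvatureDeriv n).continuousOn
        (hγ.smooth_curvatureDeriv (n + 2)).continuousOn

/-- Interpolation through logarithms needs positive norms. If ‖k‖ > 0, the Poincaré inequality makes
every norm up to order m + 2 positive. If ‖k‖ = 0, log-convexity propagates zero up to order m + 1
only, which is why i is bounded by m + 1. -/
theorem curvatureNorm_mul_le (h : IsNeumannCurve m e a b γ) (he : ‖e‖ = 1)
    (hsmall : length γ * curvatureEnergy γ < 1) {i j l p : ℕ} (hi : i ≤ m + 1) (hj : j ≤ m + 2)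
    (hl : l ≤ m + 2) (hp : p ≤ m + 2) (hsum : i + j + l + p = 2 * (m + 2)) :
    curvatureNorm γ i * curvatureNorm γ j * curvatureNorm γ l * curvatureNorm γ p ≤
      curvatureNorm γ 0 ^ 2 * curvatureNorm γ (m + 2) ^ 2 := by
  rcases (curvatureNorm_nonneg γ 0).eq_or_lt with h0 | h0
  · have hz : ∀ n ≤ m + 1, curvatureNorm γ n = 0 := fun n => by
      induction n with
      | zero => exact fun _ => h0.symm
      | succ n ih =>
        intro hn
        have := h.curvatureNorm_logConvex (n := n) (by omega)
        rw [ih (by omega), zero_mul] at this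
        exact pow_eq_zero_iff two_ne_zero |>.1 (this.antisymm (sq_nonneg _))
    simp [hz i hi, ← h0]
  · refine mul_le_of_logConvex (by omega) (fun n hn => ?_) (fun n hn => h.curvatureNorm_logConvex hn)
      (by omega) hj hl hp hsum
    refine (curvatureNorm_nonneg γ n).lt_of_ne fun hn0 => ?_
    have := h.curvatureNorm_zero_le he hsmall hn
    rw [← hn0, mul_zero] at this
    exact absurd h0 (not_lt.2 this)

/-- The derivatives of cubic expressions in curvature of odd total order vanish at the ends. -/
theorem iterate_cubic_eq_zero (h : IsNeumannCurve m e a b γ) {x : ℝ} (hx : x = -1 ∨ x = 1)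
    (n : ℕ) {i j l : ℕ} (hodd : Odd (n + (i + j + l))) (hle : n + (i + j + l) ≤ 2 * m + 1) :
    (arcDeriv γ)^[n] (curvatureDeriv γ i * curvatureDeriv γ j * curvatureDeriv γ l) x = 0 := by
  have hγ := h.isRegularCurve
  have hxI : x ∈ I := by rcases hx with rfl | rfl <;> simp [I]
  induction n generalizing i j l with
  | zero =>
    have hz : ∀ {n}, Odd n → n ≤ 2 * m + 1 → curvatureDeriv γ n x = 0 := fun hn hle => by
      rcases hx with rfl | rfl
      · exact (h.odd_deriv_eq_zero hn hle).1
      · exact (h.odd_deriv_eq_zero hn hle).2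
    simp only [Function.iterate_zero, id_eq, Pi.mul_apply, mul_eq_zero]
    -- Three nonvanishing factors would all have even order, contradicting the odd total.
    by_contra! hne
    have hE : ∀ {n}, n ≤ 2 * m + 1 → curvatureDeriv γ n x ≠ 0 → Even n := fun hle hn =>
      Nat.not_odd_iff_even.1 fun ho => hn (hz ho hle)
    have h1 := hE (by omega) hne.1.1
    have h2 := hE (by omega) hne.1.2
    have h3 := hE (by omega) hne.2
    rw [zero_add, ← Nat.not_even_iff_odd] at hodd
    exact hodd ((h1.add h2).add h3)
  | succ n ih =>
    rw [hγ.iterate_cubic_succ n i j l hxI, ih (by grind) (by omega), ih (by grind) (by omega),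
      ih (by grind) (by omega)]
    simp

/-- The basic cubic estimate. -/
theorem abs_arcIntegral_cubic_le (h : IsNeumannCurve m e a b γ) (he : ‖e‖ = 1)
    (hsmall : length γ * curvatureEnergy γ < 1) (n : ℕ) {i j l : ℕ}
    (hsum : n + (i + j + l) = m + 1) :
    |arcIntegral γ ((arcDeriv γ)^[n] (curvatureDeriv γ i * curvatureDeriv γ j *
      curvatureDeriv γ l) * curvatureDeriv γ (m + 1))| ≤
      3 ^ n * (length γ * curvatureEnergy γ * curvatureNorm γ (m + 2) ^ 2) := by
  have hγ := h.isRegularCurve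
  have hL := hγ.length_pos
  have hk := fun n => (hγ.smooth_curvatureDeriv n)
  induction n generalizing i j l with
  | zero =>
    have hc : ∀ n, ContinuousOn (curvatureDeriv γ n) I := fun n => (hk n).continuousOn
    have h1 := hγ.arcIntegral_mul_le (hc i) (hc (m + 1))
    have hmono := hγ.arcIntegral_mono
      (f := fun x => |(curvatureDeriv γ i * curvatureDeriv γ j * curvatureDeriv γ l *
        curvatureDeriv γ (m + 1)) x|)
      (g := fun x => (length γ * curvatureNorm γ (j + 1) * curvatureNorm γ (l + 1)) *
        (|curvatureDeriv γ i x| * |curvatureDeriv γ (m + 1) x|))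
      ((((hc i).mul (hc j)).mul (hc l)).mul (hc (m + 1))).abs
      (continuousOn_const.mul ((hc i).abs.mul (hc (m + 1)).abs)) fun x hx => ?_
    · rw [IsRegularCurve.arcIntegral_const_mul] at hmono
      -- The uniform bounds on the factors of orders j and l each cost one derivative and √L, so the
      -- total order is (m + 1) + (m + 1) + 2 = 2(m + 2).
      have h2 := h.curvatureNorm_mul_le he hsmall (i := i) (j := m + 1) (l := j + 1) (p := l + 1)
        (by omega) (by omega) (by omega) (by omega) (by omega)
      rw [curvatureNorm_zero_sq] at h2
      rw [pow_zero, one_mul]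
      refine (IsRegularCurve.abs_arcIntegral_le _).trans (hmono.trans ?_)
      calc _ ≤ length γ * curvatureNorm γ (j + 1) * curvatureNorm γ (l + 1) *
            (curvatureNorm γ i * curvatureNorm γ (m + 1)) :=
            mul_le_mul_of_nonneg_left h1 (mul_nonneg (mul_nonneg hL.le (curvatureNorm_nonneg _ _))
              (curvatureNorm_nonneg _ _))
        _ = length γ * (curvatureNorm γ i * curvatureNorm γ (m + 1) * curvatureNorm γ (j + 1) *
            curvatureNorm γ (l + 1)) := by ring
        _ ≤ _ := by
          rw [mul_assoc (length γ) (curvatureEnergy γ)]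
          exact mul_le_mul_of_nonneg_left h2 hL.le
    · have hj := h.abs_curvatureDeriv_le he hsmall (n := j) (by omega) hx
      have hl := h.abs_curvatureDeriv_le he hsmall (n := l) (by omega) hx
      have hjl := mul_le_mul hj hl (abs_nonneg _)
        (mul_nonneg (Real.sqrt_nonneg _) (curvatureNorm_nonneg _ _))
      have hs := Real.mul_self_sqrt hL.le
      simp only [Pi.mul_apply, abs_mul]
      calc _ = (|curvatureDeriv γ j x| * |curvatureDeriv γ l x|) *
            (|curvatureDeriv γ i x| * |curvatureDeriv γ (m + 1) x|) := by ring
        _ ≤ _ := mul_le_mul_of_nonneg_right hjl (by positivity)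
        _ = (√(length γ) * √(length γ)) * curvatureNorm γ (j + 1) * curvatureNorm γ (l + 1) *
            (|curvatureDeriv γ i x| * |curvatureDeriv γ (m + 1) x|) := by ring
        _ = _ := by rw [hs]
  | succ n ih =>
    have hs := fun i j l => hγ.smooth_iterate (smooth_mul (smooth_mul (hk i) (hk j)) (hk l)) n
    have hc := fun i j l => (smooth_mul (hs i j l) (hk (m + 1))).continuousOn
    have hadd : arcIntegral γ ((arcDeriv γ)^[n + 1] (curvatureDeriv γ i * curvatureDeriv γ j *
        curvatureDeriv γ l) * curvatureDeriv γ (m + 1)) =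
        arcIntegral γ ((arcDeriv γ)^[n] (curvatureDeriv γ (i + 1) * curvatureDeriv γ j *
          curvatureDeriv γ l) * curvatureDeriv γ (m + 1)) +
        arcIntegral γ ((arcDeriv γ)^[n] (curvatureDeriv γ i * curvatureDeriv γ (j + 1) *
          curvatureDeriv γ l) * curvatureDeriv γ (m + 1)) +
        arcIntegral γ ((arcDeriv γ)^[n] (curvatureDeriv γ i * curvatureDeriv γ j *
          curvatureDeriv γ (l + 1)) * curvatureDeriv γ (m + 1)) := by
      rw [← hγ.arcIntegral_add (hc _ _ _) (hc _ _ _), ← hγ.arcIntegral_add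
        ((hc _ _ _).add (hc _ _ _)) (hc _ _ _)]
      refine IsRegularCurve.arcIntegral_congr fun x hx => ?_
      simp only [Pi.add_apply, Pi.mul_apply]
      rw [hγ.iterate_cubic_succ n i j l hx]
      ring
    -- Each application of the Leibniz rule triples the number of terms, whence the factor 3 ^ n.
    rw [hadd]
    refine (abs_add_three _ _ _).trans ?_
    have h1 := ih (i := i + 1) (j := j) (l := l) (by omega)
    have h2 := ih (i := i) (j := j + 1) (l := l) (by omega)
    have h3 := ih (i := i) (j := j) (l := l + 1) (by omega)
    rw [pow_succ]
    linarith

/-- Control of the reaction term of the evolution of the energy. -/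
theorem abs_arcIntegral_reaction_le (h : IsNeumannCurve m e a b γ) (he : ‖e‖ = 1)
    (hsmall : length γ * curvatureEnergy γ < 1) :
    |arcIntegral γ ((curvature γ * curvature γ * curvature γ) * curvatureDeriv γ (2 * m + 2))| ≤
      3 ^ (m + 1) * (length γ * curvatureEnergy γ * curvatureNorm γ (m + 2) ^ 2) := by
  have hγ := h.isRegularCurve
  have hk := hγ.smooth_curvature
  -- The second factor has order 2m + 1 - i. It vanishes for even i, while for odd i the derivative
  -- of k³ does.
  have hb : ∀ i < m + 1, ∀ x : ℝ, x = -1 ∨ x = 1 →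
      (arcDeriv γ)^[i] (curvature γ * curvature γ * curvature γ) x *
        curvatureDeriv γ (m + 1 + (m + 1 - 1 - i)) x = 0 := fun i hi x hx => by
    rcases Nat.even_or_odd i with hev | hodd
    · have hz := h.odd_deriv_eq_zero (n := m + 1 + (m + 1 - 1 - i)) (by grind) (by omega)
      rcases hx with rfl | rfl
      · rw [hz.1, mul_zero]
      · rw [hz.2, mul_zero]
    · have := h.iterate_cubic_eq_zero hx i (i := 0) (j := 0) (l := 0) (by simpa using hodd)
        (by omega)
      exact mul_eq_zero_of_left this _
  have hp := hγ.arcIntegral_mul_curvatureDeriv ((hk.mul hk).mul hk) (m + 1) (m + 1)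
    (fun i hi => hb i hi _ (Or.inl rfl)) (fun i hi => hb i hi _ (Or.inr rfl))
  rw [show 2 * m + 2 = m + 1 + (m + 1) by ring]
  refine (congrArg abs hp).le.trans ?_
  rw [abs_mul, abs_pow, abs_neg, abs_one, one_pow, one_mul]
  exact h.abs_arcIntegral_cubic_le he hsmall (m + 1) (i := 0) (j := 0) (l := 0) (by omega)

/-- This identifies the rate of change of length. The boundary terms pair orders i and 2m + 1 - i,
whose sum is odd. -/
theorem arcIntegral_curvature_mul (h : IsNeumannCurve m e a b γ) :
    arcIntegral γ (curvature γ * curvatureDeriv γ (2 * m + 2)) =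
      (-1) ^ (m + 1) * curvatureNorm γ (m + 1) ^ 2 := by
  have hγ := h.isRegularCurve
  have hb : ∀ i < m + 1, _ := fun i hi => h.mul_deriv_eq_zero (i := i)
    (j := m + 1 + (m + 1 - 1 - i)) (by grind) (by omega) (by omega)
  have := hγ.arcIntegral_mul_curvatureDeriv hγ.smooth_curvature (m + 1) (m + 1)
    (fun i hi => (hb i hi).1) (fun i hi => (hb i hi).2)
  rw [show 2 * m + 2 = m + 1 + (m + 1) by ring, this, curvatureNorm_sq]
  congr 1
  exact IsRegularCurve.arcIntegral_congr fun x _ => (sq (curvatureDeriv γ (m + 1) x)).symm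

/-- The leading term of the evolution of the energy. -/
theorem arcIntegral_curvature_mul_top (h : IsNeumannCurve m e a b γ)
    (hl : curvatureDeriv γ (2 * m + 3) (-1) = 0) (hr : curvatureDeriv γ (2 * m + 3) 1 = 0) :
    arcIntegral γ (curvature γ * curvatureDeriv γ (2 * m + 4)) =
      (-1) ^ m * curvatureNorm γ (m + 2) ^ 2 := by
  have hγ := h.isRegularCurve
  have hb : ∀ i < m + 2, curvatureDeriv γ i (-1) *
      curvatureDeriv γ (m + 2 + (m + 2 - 1 - i)) (-1) = 0 ∧
      curvatureDeriv γ i 1 * curvatureDeriv γ (m + 2 + (m + 2 - 1 - i)) 1 = 0 := fun i hi => by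
    -- Only the term i = 0 involves order 2m + 3, beyond the Neumann conditions; parity settles the
    -- others.
    rcases i with _ | i
    · rw [show m + 2 + (m + 2 - 1 - 0) = 2 * m + 3 by omega, hl, hr]
      simp
    · exact h.mul_deriv_eq_zero (by grind) (by omega) (by omega)
  have := hγ.arcIntegral_mul_curvatureDeriv hγ.smooth_curvature (m + 2) (m + 2)
    (fun i hi => (hb i hi).1) (fun i hi => (hb i hi).2)
  rw [show 2 * m + 4 = m + 2 + (m + 2) by ring, this, curvatureNorm_sq, pow_add (-1 : ℝ) m 2]
  rw [neg_one_sq, mul_one]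
  congr 1
  exact IsRegularCurve.arcIntegral_congr fun x _ => (sq (curvatureDeriv γ (m + 2) x)).symm

end IsNeumannCurve
/-! ### Functions on space-time -/

/-- The open space-time strip `(0, T) × [-1, 1]`. -/
def strip (T : ℝ) : Set (ℝ × ℝ) := Set.Ioo 0 T ×ˢ I

theorem uniqueDiffOn_strip (T : ℝ) : UniqueDiffOn ℝ (strip T) :=
  (uniqueDiffOn_Ioo _ _).prod uniqueDiffOn_I

/-- Gives symmetry of second derivatives also at the boundary points x = ±1. -/
theorem strip_subset_closure (T : ℝ) : strip T ⊆ closure (interior (strip T)) := by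
  rw [strip, interior_prod_eq, closure_prod_eq, interior_Ioo, I, interior_Icc,
    closure_Ioo (by norm_num : (-1 : ℝ) ≠ 1)]
  exact Set.prod_mono subset_closure subset_rfl

section Strip

variable {F : Type*} [NormedAddCommGroup F] [NormedSpace ℝ F] {T : ℝ}

/-- Smoothness on the space-time strip. -/
def SmoothOnStrip (T : ℝ) (u : ℝ → ℝ → F) : Prop :=
  ContDiffOn ℝ ∞ (fun p : ℝ × ℝ => u p.1 p.2) (strip T)

namespace SmoothOnStrip

variable {u : ℝ → ℝ → F}

theorem slice (hu : SmoothOnStrip T u) {t : ℝ} (ht : t ∈ Set.Ioo 0 T) :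
    ContDiffOn ℝ ∞ (u t) I :=
  hu.comp (f := fun x : ℝ => (t, x)) (contDiff_const.prodMk contDiff_id).contDiffOn
    fun _ hx => ⟨ht, hx⟩

theorem hasFDerivWithinAt (hu : SmoothOnStrip T u) {t x : ℝ} (ht : t ∈ Set.Ioo 0 T) (hx : x ∈ I) :
    HasFDerivWithinAt (fun p : ℝ × ℝ => u p.1 p.2)
      (fderivWithin ℝ (fun p : ℝ × ℝ => u p.1 p.2) (strip T) (t, x)) (strip T) (t, x) :=
  (hu.differentiableOn (by simp) (t, x) ⟨ht, hx⟩).hasFDerivWithinAt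

theorem derivWithin_eq (hu : SmoothOnStrip T u) {t x : ℝ} (ht : t ∈ Set.Ioo 0 T) (hx : x ∈ I) :
    derivWithin (u t) I x =
      fderivWithin ℝ (fun p : ℝ × ℝ => u p.1 p.2) (strip T) (t, x) (0, 1) := by
  have h1 : HasDerivWithinAt (fun y : ℝ => (t, y)) ((0 : ℝ), (1 : ℝ)) I x :=
    ((hasDerivAt_const x t).prodMk (hasDerivAt_id x)).hasDerivWithinAt
  exact ((hu.hasFDerivWithinAt ht hx).comp_hasDerivWithinAt x h1
    (fun y hy => ⟨ht, hy⟩)).derivWithin (uniqueDiffOn_I x hx)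

theorem hasDerivAt (hu : SmoothOnStrip T u) {t x : ℝ} (ht : t ∈ Set.Ioo 0 T) (hx : x ∈ I) :
    HasDerivAt (fun s => u s x)
      (fderivWithin ℝ (fun p : ℝ × ℝ => u p.1 p.2) (strip T) (t, x) (1, 0)) t := by
  have h1 : HasDerivWithinAt (fun s : ℝ => (s, x)) ((1 : ℝ), (0 : ℝ)) (Set.Ioo 0 T) t :=
    ((hasDerivAt_id t).prodMk (hasDerivAt_const t x)).hasDerivWithinAt
  have h2 : Set.MapsTo (fun s : ℝ => (s, x)) (Set.Ioo 0 T) (strip T) := fun s hs => ⟨hs, hx⟩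
  exact ((hu.hasFDerivWithinAt ht hx).comp_hasDerivWithinAt t h1 h2).hasDerivAt (Ioo_mem_nhds ht.1 ht.2)

theorem smooth_fderivWithin_apply (hu : SmoothOnStrip T u) (v : ℝ × ℝ) :
    SmoothOnStrip T fun t x =>
      fderivWithin ℝ (fun p : ℝ × ℝ => u p.1 p.2) (strip T) (t, x) v :=
  (ContDiffOn.fderivWithin hu (uniqueDiffOn_strip T) le_rfl).clm_apply contDiffOn_const

theorem congr {u' : ℝ → ℝ → F} (hu : SmoothOnStrip T u)
    (h : ∀ t ∈ Set.Ioo 0 T, ∀ x ∈ I, u' t x = u t x) : SmoothOnStrip T u' :=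
  ContDiffOn.congr hu fun p hp => h p.1 hp.1 p.2 hp.2

theorem smooth_derivWithin (hu : SmoothOnStrip T u) :
    SmoothOnStrip T fun t x => derivWithin (u t) I x :=
  (hu.smooth_fderivWithin_apply (0, 1)).congr fun _ ht _ hx => hu.derivWithin_eq ht hx

/-- Space and time derivatives commute. -/
theorem hasDerivAt_derivWithin (hu : SmoothOnStrip T u) {w : ℝ → ℝ → F}
    (hw : ∀ t ∈ Set.Ioo 0 T, ∀ x ∈ I, HasDerivAt (fun s => u s x) (w t x) t) {t x : ℝ}
    (ht : t ∈ Set.Ioo 0 T) (hx : x ∈ I) :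
    HasDerivAt (fun s => derivWithin (u s) I x) (derivWithin (w t) I x) t := by
  have hmem : (t, x) ∈ strip T := ⟨ht, hx⟩
  have hsymm : IsSymmSndFDerivWithinAt ℝ (fun p : ℝ × ℝ => u p.1 p.2) (strip T) (t, x) :=
    ContDiffWithinAt.isSymmSndFDerivWithinAt (hu _ hmem)
      (by rw [minSmoothness_of_isRCLikeNormedField]; exact ENat.LEInfty.out)
      (uniqueDiffOn_strip T) (strip_subset_closure T hmem) hmem
  have happ : ∀ v : ℝ × ℝ, fderivWithin ℝ (fun p : ℝ × ℝ =>
      fderivWithin ℝ (fun p : ℝ × ℝ => u p.1 p.2) (strip T) (p.1, p.2) v) (strip T) (t, x) =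
      (fderivWithin ℝ (fderivWithin ℝ (fun p : ℝ × ℝ => u p.1 p.2) (strip T))
        (strip T) (t, x)).flip v := fun v => by
    have hd := (ContDiffOn.fderivWithin (m := ∞) hu (uniqueDiffOn_strip T)
      le_rfl).differentiableOn (by simp) (t, x) hmem
    have := hd.hasFDerivWithinAt.clm_apply (hasFDerivWithinAt_const v (t, x) (strip T))
    have h2 := this.fderivWithin (uniqueDiffOn_strip T _ hmem)
    refine Eq.trans h2 ?_
    ext <;> simp
  have h1 := (hu.smooth_fderivWithin_apply (0, 1)).hasDerivAt ht hx
  have h2 : derivWithin (w t) I x = fderivWithin ℝ (fun p : ℝ × ℝ =>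
      fderivWithin ℝ (fun p : ℝ × ℝ => u p.1 p.2) (strip T) (p.1, p.2) (1, 0))
      (strip T) (t, x) (0, 1) := by
    have hE : Set.EqOn (w t) (fun y =>
        fderivWithin ℝ (fun p : ℝ × ℝ => u p.1 p.2) (strip T) (t, y) (1, 0)) I :=
      fun y hy => (hw t ht y hy).unique (hu.hasDerivAt ht hy)
    rw [derivWithin_congr hE (hE hx)]
    exact (hu.smooth_fderivWithin_apply (1, 0)).derivWithin_eq ht hx
  rw [h2, happ, ContinuousLinearMap.flip_apply, hsymm, ← ContinuousLinearMap.flip_apply, ← happ]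
  refine h1.congr_of_eventuallyEq ?_
  filter_upwards [Ioo_mem_nhds ht.1 ht.2] with s hs
  exact hu.derivWithin_eq hs hx

end SmoothOnStrip
end Strip

/-- Continuity of parametric integrals over `[-1, 1]`. -/
theorem continuousOn_integral {T : ℝ} {g : ℝ → ℝ → ℝ}
    (hg : ContinuousOn (fun p : ℝ × ℝ => g p.1 p.2) (Set.Ico 0 T ×ˢ I)) :
    ContinuousOn (fun t => ∫ x in (-1 : ℝ)..1, g t x) (Set.Ico 0 T) := by
  intro t ht
  -- Stopping at b < T makes the space-time region compact, so a constant dominates the integrand.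
  obtain ⟨b, htb, hbT⟩ := exists_between ht.2
  have hK : IsCompact (Set.Icc 0 b ×ˢ I) := isCompact_Icc.prod isCompact_Icc
  have hsub : Set.Icc 0 b ×ˢ I ⊆ Set.Ico 0 T ×ˢ I :=
    Set.prod_mono (Set.Icc_subset_Ico_right hbT) subset_rfl
  obtain ⟨C, hC⟩ := hK.exists_bound_of_continuousOn (hg.mono hsub)
  have hI : Set.uIoc (-1 : ℝ) 1 ⊆ I := by
    rw [Set.uIoc_of_le (by norm_num)]; exact Set.Ioc_subset_Icc_self
  have hslice : ∀ s ∈ Set.Ico 0 T, ContinuousOn (g s) I := fun s hs =>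
    hg.comp (f := fun x : ℝ => (s, x)) (by fun_prop) fun x hx => ⟨hs, hx⟩
  have hnear : ∀ᶠ s in nhdsWithin t (Set.Ico 0 T), s ∈ Set.Ico 0 b :=
    (eventually_mem_nhdsWithin.and (mem_nhdsWithin_of_mem_nhds (Iio_mem_nhds htb))).mono
      fun s hs => ⟨hs.1.1, hs.2⟩
  refine intervalIntegral.continuousWithinAt_of_dominated_interval (bound := fun _ => C) ?_ ?_
    intervalIntegrable_const ?_
  · filter_upwards [eventually_mem_nhdsWithin] with s hs
    exact ((hslice s hs).mono hI).aestronglyMeasurable measurableSet_uIoc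
  · filter_upwards [hnear] with s hs
    exact Filter.Eventually.of_forall fun x hx => hC (s, x) ⟨⟨hs.1, hs.2.le⟩, hI hx⟩
  · refine Filter.Eventually.of_forall fun x hx => ?_
    exact (hg.comp (f := fun s : ℝ => (s, x)) (by fun_prop) fun s hs => ⟨hs, hI hx⟩) t ht

/-- Differentiation under the integral sign. -/
theorem SmoothOnStrip.hasDerivAt_integral {T : ℝ} {u w : ℝ → ℝ → ℝ} (hu : SmoothOnStrip T u)
    (hw : ∀ t ∈ Set.Ioo 0 T, ∀ x ∈ I, HasDerivAt (fun s => u s x) (w t x) t) {t : ℝ}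
    (ht : t ∈ Set.Ioo 0 T) :
    HasDerivAt (fun s => ∫ x in (-1 : ℝ)..1, u s x) (∫ x in (-1 : ℝ)..1, w t x) t := by
  obtain ⟨a, ha0, hat⟩ := exists_between ht.1
  obtain ⟨b, htb, hbT⟩ := exists_between ht.2
  have hK : IsCompact (Set.Icc a b ×ˢ I) := isCompact_Icc.prod isCompact_Icc
  have hab : Set.Icc a b ⊆ Set.Ioo 0 T := fun s hs => ⟨ha0.trans_le hs.1, hs.2.trans_lt hbT⟩
  have hsub : Set.Icc a b ×ˢ I ⊆ strip T := Set.prod_mono hab subset_rfl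
  -- By uniqueness `w` is the time derivative of the smooth `u`, hence continuous and bounded on
  -- compact sets.
  have hws : SmoothOnStrip T w := (hu.smooth_fderivWithin_apply (1, 0)).congr
    fun s hs x hx => (hw s hs x hx).unique (hu.hasDerivAt hs hx)
  obtain ⟨C, hC⟩ := hK.exists_bound_of_continuousOn (ContDiffOn.continuousOn hws |>.mono hsub)
  have hI : Set.uIoc (-1 : ℝ) 1 ⊆ I := by
    rw [Set.uIoc_of_le (by norm_num)]; exact Set.Ioc_subset_Icc_self
  refine (intervalIntegral.hasDerivAt_integral_of_dominated_loc_of_deriv_le (F := u) (F' := w)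
    (bound := fun _ => C) (Icc_mem_nhds hat htb) ?_
    (intervalIntegrable_of_continuousOn (hu.slice ht).continuousOn) ?_ ?_
    intervalIntegrable_const ?_).2
  · filter_upwards [Ioo_mem_nhds ht.1 ht.2] with s hs
    exact ((hu.slice hs).continuousOn.mono hI).aestronglyMeasurable measurableSet_uIoc
  · exact ((hws.slice ht).continuousOn.mono hI).aestronglyMeasurable measurableSet_uIoc
  · exact Filter.Eventually.of_forall fun x hx s hs => hC (s, x) ⟨hs, hI hx⟩
  · exact Filter.Eventually.of_forall fun x hx s hs => hw s (hab hs) x (hI hx)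

/-! ### Evolution equations along the flow -/

/-- The normal speed of the flow. -/
noncomputable def normalSpeed (m : ℕ) (γ : ℝ → Plane) (x : ℝ) : ℝ :=
  (-1) ^ (m + 1) * curvatureDeriv γ (2 * m + 2) x

theorem arcDeriv_const_mul {γ : ℝ → Plane} (c : ℝ) {f : ℝ → ℝ} (hf : ContDiffOn ℝ ∞ f I) :
    Set.EqOn (arcDeriv γ fun x => c * f x) (fun x => c * arcDeriv γ f x) I := fun x hx => by
  simp only [arcDeriv, smul_eq_mul,
    ((hasDerivWithinAt_of_smooth hf hx).const_mul c).derivWithin (uniqueDiffOn_I x hx)]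
  ring

namespace IsRegularCurve

variable {γ : ℝ → Plane}

theorem smooth_normalSpeed (hγ : IsRegularCurve γ) (m : ℕ) :
    ContDiffOn ℝ ∞ (normalSpeed m γ) I :=
  contDiffOn_const.mul (hγ.smooth_curvatureDeriv _)

theorem arcDeriv_normalSpeed (hγ : IsRegularCurve γ) (m : ℕ) :
    Set.EqOn (arcDeriv γ (normalSpeed m γ))
      (fun x => (-1) ^ (m + 1) * curvatureDeriv γ (2 * m + 3) x) I := by
  rw [curvatureDeriv_succ]
  exact arcDeriv_const_mul _ (hγ.smooth_curvatureDeriv _)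

theorem arcDeriv_arcDeriv_normalSpeed (hγ : IsRegularCurve γ) (m : ℕ) :
    Set.EqOn (arcDeriv γ (arcDeriv γ (normalSpeed m γ)))
      (fun x => (-1) ^ (m + 1) * curvatureDeriv γ (2 * m + 4) x) I := by
  rw [curvatureDeriv_succ γ (2 * m + 3)]
  exact (arcDeriv_congr (hγ.arcDeriv_normalSpeed m)).trans
    (arcDeriv_const_mul _ (hγ.smooth_curvatureDeriv _))

theorem velocity_apply {x : ℝ} (hγ : IsRegularCurve γ) (hx : x ∈ I) (i : Fin 2) :
    velocity γ x i = speed γ x * tangent γ x i := by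
  have h := (hγ.speed_pos hx).ne'
  change _ = speed γ x * ((speed γ x)⁻¹ * velocity γ x i)
  field_simp

end IsRegularCurve

namespace IsSolution

variable {m : ℕ} {e : Plane} {a b T : ℝ} {γ : ℝ → ℝ → Plane}

theorem isNeumannCurve (h : IsSolution m e a b T γ) {t : ℝ} (ht : t ∈ Set.Ioo 0 T) :
    IsNeumannCurve m e a b (γ t) := h.neumann t ⟨ht.1.le, ht.2⟩

theorem isRegularCurve (h : IsSolution m e a b T γ) {t : ℝ} (ht : t ∈ Set.Ioo 0 T) :
    IsRegularCurve (γ t) := (h.isNeumannCurve ht).isRegularCurve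

theorem smooth_velocity (h : IsSolution m e a b T γ) :
    SmoothOnStrip T fun t => velocity (γ t) :=
  SmoothOnStrip.smooth_derivWithin (u := γ) h.smooth

theorem smooth_speed (h : IsSolution m e a b T γ) : SmoothOnStrip T fun t => speed (γ t) :=
  ContDiffOn.norm ℝ h.smooth_velocity fun _ hp => (h.isRegularCurve hp.1).regular _ hp.2

theorem smooth_inv_speed (h : IsSolution m e a b T γ) :
    SmoothOnStrip T fun t x => (speed (γ t) x)⁻¹ :=
  ContDiffOn.inv h.smooth_speed fun _ hp => ((h.isRegularCurve hp.1).speed_pos hp.2).ne'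

theorem smooth_arcDeriv (h : IsSolution m e a b T γ) {F : Type*} [NormedAddCommGroup F]
    [NormedSpace ℝ F] {f : ℝ → ℝ → F} (hf : SmoothOnStrip T f) :
    SmoothOnStrip T fun t => arcDeriv (γ t) (f t) :=
  ContDiffOn.smul h.smooth_inv_speed hf.smooth_derivWithin

theorem smooth_tangent (h : IsSolution m e a b T γ) : SmoothOnStrip T fun t => tangent (γ t) :=
  h.smooth_arcDeriv (f := γ) h.smooth

theorem smooth_tangent_apply (h : IsSolution m e a b T γ) (i : Fin 2) :
    SmoothOnStrip T fun t x => tangent (γ t) x i :=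
  contDiffOn_euclidean.1 h.smooth_tangent i

theorem smooth_normal (h : IsSolution m e a b T γ) : SmoothOnStrip T fun t => normal (γ t) := by
  refine contDiffOn_euclidean.2 fun i => ?_
  fin_cases i
  · simpa [normal, rot] using ContDiffOn.neg (h.smooth_tangent_apply 1)
  · exact h.smooth_tangent_apply 0

theorem smooth_curvature (h : IsSolution m e a b T γ) :
    SmoothOnStrip T fun t => curvature (γ t) :=
  ContDiffOn.inner ℝ (h.smooth_arcDeriv h.smooth_tangent) h.smooth_normal

theorem smooth_curvatureDeriv (h : IsSolution m e a b T γ) (n : ℕ) :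
    SmoothOnStrip T fun t => curvatureDeriv (γ t) n := by
  induction n with
  | zero => exact h.smooth_curvature
  | succ n ih => simpa only [curvatureDeriv_succ] using h.smooth_arcDeriv ih

theorem hasDerivAt_apply (h : IsSolution m e a b T γ) {t x : ℝ} (ht : t ∈ Set.Ioo 0 T)
    (hx : x ∈ I) (i : Fin 2) :
    HasDerivAt (fun s => γ s x i) (normalSpeed m (γ t) x * normal (γ t) x i) t :=
  (EuclideanSpace.proj (𝕜 := ℝ) i).hasFDerivAt.comp_hasDerivAt t (h.flow t ht x hx)

theorem smooth_apply (h : IsSolution m e a b T γ) (i : Fin 2) :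
    SmoothOnStrip T fun t x => γ t x i :=
  contDiffOn_euclidean.1 h.smooth i

theorem hasDerivAt_velocity_apply (h : IsSolution m e a b T γ) {t x : ℝ} (ht : t ∈ Set.Ioo 0 T)
    (hx : x ∈ I) (i : Fin 2) :
    HasDerivAt (fun s => velocity (γ s) x i)
      (derivWithin (fun y => normalSpeed m (γ t) y * normal (γ t) y i) I x) t := by
  refine ((h.smooth_apply i).hasDerivAt_derivWithin
    (fun s hs y hy => h.hasDerivAt_apply hs hy i) ht hx).congr_of_eventuallyEq ?_
  filter_upwards [Ioo_mem_nhds ht.1 ht.2] with s hs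
  exact (IsRegularCurve.derivWithin_apply (h.isRegularCurve hs).smooth i hx).symm

/-- First coordinate of γ_{xt} = (Fν)_x = F_x ν - F k |γ_x| τ. -/
theorem hasDerivAt_velocity_zero (h : IsSolution m e a b T γ) {t x : ℝ} (ht : t ∈ Set.Ioo 0 T)
    (hx : x ∈ I) :
    HasDerivAt (fun s => velocity (γ s) x 0)
      (-(derivWithin (normalSpeed m (γ t)) I x * tangent (γ t) x 1 +
        normalSpeed m (γ t) x * (curvature (γ t) x * speed (γ t) x * tangent (γ t) x 0))) t := by
  refine (h.hasDerivAt_velocity_apply ht hx 0).congr_deriv ?_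
  have hγ := h.isRegularCurve ht
  have h1 := hasDerivWithinAt_of_smooth (hγ.smooth_tangent_apply 1) hx
  rw [hγ.derivWithin_tangent_one hx] at h1
  have h2 := ((hasDerivWithinAt_of_smooth (hγ.smooth_normalSpeed m) hx).mul h1).neg.derivWithin
    (uniqueDiffOn_I x hx)
  rw [← h2]
  refine congrArg (fun f => derivWithin f I x) (funext fun y => ?_)
  simp [normal, rot]

theorem hasDerivAt_velocity_one (h : IsSolution m e a b T γ) {t x : ℝ} (ht : t ∈ Set.Ioo 0 T)
    (hx : x ∈ I) :
    HasDerivAt (fun s => velocity (γ s) x 1)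
      (derivWithin (normalSpeed m (γ t)) I x * tangent (γ t) x 0 +
        normalSpeed m (γ t) x * -(curvature (γ t) x * speed (γ t) x * tangent (γ t) x 1)) t := by
  refine (h.hasDerivAt_velocity_apply ht hx 1).congr_deriv ?_
  have hγ := h.isRegularCurve ht
  have h1 := hasDerivWithinAt_of_smooth (hγ.smooth_tangent_apply 0) hx
  rw [hγ.derivWithin_tangent_zero hx] at h1
  have h2 := ((hasDerivWithinAt_of_smooth (hγ.smooth_normalSpeed m) hx).mul h1).derivWithin
    (uniqueDiffOn_I x hx)
  rw [← h2]
  refine congrArg (fun f => derivWithin f I x) (funext fun y => ?_)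
  simp [normal, rot]

/-- Only the tangential part of γ_{xt} changes |γ_x|; the part F_x ν is orthogonal to γ_x. -/
theorem hasDerivAt_speed (h : IsSolution m e a b T γ) {t x : ℝ} (ht : t ∈ Set.Ioo 0 T)
    (hx : x ∈ I) :
    HasDerivAt (fun s => speed (γ s) x)
      (-(normalSpeed m (γ t) x * curvature (γ t) x * speed (γ t) x)) t := by
  have hγ := h.isRegularCurve ht
  have hv := hγ.speed_pos hx
  have hsq : ∀ s, velocity (γ s) x 0 ^ 2 + velocity (γ s) x 1 ^ 2 = speed (γ s) x ^ 2 :=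
    fun s => by simpa [speed] using (EuclideanSpace.norm_sq_eq (velocity (γ s) x)).symm
  have h1 := (((h.hasDerivAt_velocity_zero ht hx).fun_pow 2).fun_add
    ((h.hasDerivAt_velocity_one ht hx).fun_pow 2)).sqrt (by rw [hsq]; positivity)
  have hsqrt : ∀ s, √(speed (γ s) x ^ 2) = speed (γ s) x := fun s => Real.sqrt_sq (norm_nonneg _)
  simp only [hsq, hsqrt] at h1
  refine h1.congr_deriv ?_
  rw [hγ.velocity_apply hx, hγ.velocity_apply hx]
  field_simp
  have := hγ.tangent_sq hx
  simp
  linear_combination (-normalSpeed m (γ t) x * curvature (γ t) x * 2 * speed (γ t) x ^ 2) * this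

/-- In coordinates, τ_t = F_s ν: normalisation by the speed cancels the tangential part of γ_{xt}.
-/
theorem hasDerivAt_tangent_apply (h : IsSolution m e a b T γ) {t x : ℝ} (ht : t ∈ Set.Ioo 0 T)
    (hx : x ∈ I) :
    HasDerivAt (fun s => tangent (γ s) x 0)
        (-(arcDeriv (γ t) (normalSpeed m (γ t)) x * tangent (γ t) x 1)) t ∧
      HasDerivAt (fun s => tangent (γ s) x 1)
        (arcDeriv (γ t) (normalSpeed m (γ t)) x * tangent (γ t) x 0) t := by
  have hγ := h.isRegularCurve ht
  have hv := hγ.speed_pos hx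
  have hF := hγ.arcDeriv_mul_speed (normalSpeed m (γ t)) hx
  have hv' := (h.hasDerivAt_speed ht hx).fun_inv hv.ne'
  constructor
  · refine (hv'.mul (h.hasDerivAt_velocity_zero ht hx)).congr_deriv ?_
    rw [hγ.velocity_apply hx, ← hF]
    field_simp
    ring
  · refine (hv'.mul (h.hasDerivAt_velocity_one ht hx)).congr_deriv ?_
    rw [hγ.velocity_apply hx, ← hF]
    field_simp
    ring

/-- For a tangent angle θ one has k|γ_x| = θ_x and θ_t = F_s, so the time derivative is F_{sx} =
F_ss |γ_x|. The proof is this computation for τ × τ_x. -/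
theorem hasDerivAt_curvature_mul_speed (h : IsSolution m e a b T γ) {t x : ℝ}
    (ht : t ∈ Set.Ioo 0 T) (hx : x ∈ I) :
    HasDerivAt (fun s => curvature (γ s) x * speed (γ s) x)
      (arcDeriv (γ t) (arcDeriv (γ t) (normalSpeed m (γ t))) x * speed (γ t) x) t := by
  have hγ := h.isRegularCurve ht
  have hFs := hγ.smooth_arcDeriv (hγ.smooth_normalSpeed m)
  have h0 := (h.hasDerivAt_tangent_apply ht hx).1
  have h1 := (h.hasDerivAt_tangent_apply ht hx).2
  have hx0 := hasDerivWithinAt_of_smooth (hγ.smooth_tangent_apply 0) hx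
  have hx1 := hasDerivWithinAt_of_smooth (hγ.smooth_tangent_apply 1) hx
  have h0x := (h.smooth_tangent_apply 0).hasDerivAt_derivWithin
    (fun s hs y hy => (h.hasDerivAt_tangent_apply hs hy).1) ht hx
  have h1x := (h.smooth_tangent_apply 1).hasDerivAt_derivWithin
    (fun s hs y hy => (h.hasDerivAt_tangent_apply hs hy).2) ht hx
  rw [((hasDerivWithinAt_of_smooth hFs hx).fun_mul hx1).fun_neg.derivWithin
    (uniqueDiffOn_I x hx)] at h0x
  rw [((hasDerivWithinAt_of_smooth hFs hx).fun_mul hx0).derivWithin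
    (uniqueDiffOn_I x hx)] at h1x
  have hev : (fun s => curvature (γ s) x * speed (γ s) x) =ᶠ[nhds t] fun s =>
      tangent (γ s) x 0 * derivWithin (fun y => tangent (γ s) y 1) I x -
        tangent (γ s) x 1 * derivWithin (fun y => tangent (γ s) y 0) I x := by
    filter_upwards [Ioo_mem_nhds ht.1 ht.2] with s hs
    exact (h.isRegularCurve hs).curvature_mul_speed hx
  refine (((h0.fun_mul h1x).fun_sub (h1.fun_mul h0x)).congr_deriv ?_).congr_of_eventuallyEq hev
  rw [hγ.arcDeriv_mul_speed _ hx, hγ.derivWithin_tangent_zero hx, hγ.derivWithin_tangent_one hx]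
  linear_combination (derivWithin (arcDeriv (γ t) (normalSpeed m (γ t))) I x) * hγ.tangent_sq hx

/-- The evolution of the energy density. -/
theorem hasDerivAt_energyDensity (h : IsSolution m e a b T γ) {t x : ℝ}
    (ht : t ∈ Set.Ioo 0 T) (hx : x ∈ I) :
    HasDerivAt (fun s => curvature (γ s) x ^ 2 * speed (γ s) x)
      ((2 * (curvature (γ t) x * arcDeriv (γ t) (arcDeriv (γ t) (normalSpeed m (γ t))) x) +
        curvature (γ t) x * curvature (γ t) x * curvature (γ t) x * normalSpeed m (γ t) x) *
          speed (γ t) x) t := by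
  have hv := (h.isRegularCurve ht).speed_pos hx
  -- Written in this way, the density is differentiated without computing k_t.
  have hev : (fun s => curvature (γ s) x ^ 2 * speed (γ s) x) =ᶠ[nhds t] fun s =>
      (curvature (γ s) x * speed (γ s) x) ^ 2 * (speed (γ s) x)⁻¹ := by
    filter_upwards [Ioo_mem_nhds ht.1 ht.2] with s hs
    have := (h.isRegularCurve hs).speed_pos hx
    field_simp
  refine ((((h.hasDerivAt_curvature_mul_speed ht hx).fun_pow 2).fun_mul
    ((h.hasDerivAt_speed ht hx).fun_inv hv.ne')).congr_deriv ?_).congr_of_eventuallyEq hev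
  field_simp
  simp
  ring

/-- The orthogonality condition is preserved, so one more odd derivative vanishes. -/
theorem curvatureDeriv_ends (h : IsSolution m e a b T γ) (he : ‖e‖ = 1) {t : ℝ}
    (ht : t ∈ Set.Ioo 0 T) :
    curvatureDeriv (γ t) (2 * m + 3) (-1) = 0 ∧ curvatureDeriv (γ t) (2 * m + 3) 1 = 0 := by
  have hγ := h.isRegularCurve ht
  have he2 : e 0 ^ 2 + e 1 ^ 2 = 1 := by
    have h := EuclideanSpace.norm_sq_eq e
    simpa [he] using h.symm
  have key : ∀ x ∈ I,
      (∀ s ∈ Set.Ioo 0 T, e 0 * tangent (γ s) x 1 - e 1 * tangent (γ s) x 0 = 0) →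
      curvatureDeriv (γ t) (2 * m + 3) x = 0 := fun x hx hz => by
    obtain ⟨h0, h1⟩ := h.hasDerivAt_tangent_apply ht hx
    have h2 := (h1.const_mul (e 0)).fun_sub (h0.const_mul (e 1))
    have h3 : HasDerivAt (fun s => e 0 * tangent (γ s) x 1 - e 1 * tangent (γ s) x 0) 0 t := by
      refine (hasDerivAt_const t (0 : ℝ)).congr_of_eventuallyEq ?_
      filter_upwards [Ioo_mem_nhds ht.1 ht.2] with s hs
      exact hz s hs
    have h4 := h2.unique h3
    have h5 := hz t ht
    have h6 := hγ.tangent_sq hx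
    have hsq : (e 0 * tangent (γ t) x 0 + e 1 * tangent (γ t) x 1) ^ 2 = 1 := by
      linear_combination (tangent (γ t) x 0 ^ 2 + tangent (γ t) x 1 ^ 2) * he2 + h6 -
        (e 0 * tangent (γ t) x 1 - e 1 * tangent (γ t) x 0) * h5
    -- The time derivative of ⟨rot e, τ⟩ = 0 is F_s ⟨e, τ⟩, and ⟨e, τ⟩² = 1 at the ends.
    have hFs : arcDeriv (γ t) (normalSpeed m (γ t)) x = 0 := by
      linear_combination (-arcDeriv (γ t) (normalSpeed m (γ t)) x) * hsq +
        (e 0 * tangent (γ t) x 0 + e 1 * tangent (γ t) x 1) * h4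
    rw [hγ.arcDeriv_normalSpeed m hx] at hFs
    exact (mul_eq_zero.1 hFs).resolve_left (by simp)
  exact ⟨key _ left_mem_I fun s hs => (h.isNeumannCurve hs).tangent_ends.1,
    key _ right_mem_I fun s hs => (h.isNeumannCurve hs).tangent_ends.2⟩

/-- The evolution of length. -/
theorem hasDerivAt_length (h : IsSolution m e a b T γ) {t : ℝ} (ht : t ∈ Set.Ioo 0 T) :
    HasDerivAt (fun s => length (γ s)) (-curvatureNorm (γ t) (m + 1) ^ 2) t := by
  refine (h.smooth_speed.hasDerivAt_integral (fun s hs x hx => h.hasDerivAt_speed hs hx)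
    ht).congr_deriv ?_
  have h1 := (h.isNeumannCurve ht).arcIntegral_curvature_mul
  have h2 : (∫ x in (-1 : ℝ)..1, -(normalSpeed m (γ t) x * curvature (γ t) x * speed (γ t) x)) =
      -((-1) ^ (m + 1) * arcIntegral (γ t) (curvature (γ t) * curvatureDeriv (γ t) (2 * m + 2))) := by
    rw [intervalIntegral.integral_neg, ← IsRegularCurve.arcIntegral_const_mul]
    congr 1
    refine intervalIntegral.integral_congr fun x _ => ?_
    simp only [normalSpeed, Pi.mul_apply]
    ring
  rw [h2, h1, ← mul_assoc, ← mul_pow]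
  simp

/-- The evolution of the energy. -/
theorem hasDerivAt_curvatureEnergy (h : IsSolution m e a b T γ) (he : ‖e‖ = 1) {t : ℝ}
    (ht : t ∈ Set.Ioo 0 T) :
    HasDerivAt (fun s => curvatureEnergy (γ s)) (-2 * curvatureNorm (γ t) (m + 2) ^ 2 +
      (-1) ^ (m + 1) * arcIntegral (γ t) ((curvature (γ t) * curvature (γ t) * curvature (γ t)) *
        curvatureDeriv (γ t) (2 * m + 2))) t := by
  have hs : SmoothOnStrip T fun t x => curvature (γ t) x ^ 2 * speed (γ t) x :=
    ContDiffOn.mul (ContDiffOn.pow h.smooth_curvature 2) h.smooth_speed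
  refine (hs.hasDerivAt_integral (fun s hs x hx => h.hasDerivAt_energyDensity hs hx)
    ht).congr_deriv ?_
  have hγ := h.isRegularCurve ht
  have hk := hγ.smooth_curvature
  have hend := h.curvatureDeriv_ends he ht
  have h1 := (h.isNeumannCurve ht).arcIntegral_curvature_mul_top hend.1 hend.2
  have h2 := hγ.arcIntegral_add
    (f := fun x => (2 * (-1) ^ (m + 1)) *
      (curvature (γ t) * curvatureDeriv (γ t) (2 * m + 4)) x)
    (g := fun x => (-1) ^ (m + 1) * ((curvature (γ t) * curvature (γ t) * curvature (γ t)) *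
      curvatureDeriv (γ t) (2 * m + 2)) x)
    (contDiffOn_const.mul (smooth_mul hk (hγ.smooth_curvatureDeriv _))).continuousOn
    (contDiffOn_const.mul (smooth_mul (smooth_mul (smooth_mul hk hk) hk)
      (hγ.smooth_curvatureDeriv _))).continuousOn
  rw [IsRegularCurve.arcIntegral_const_mul, IsRegularCurve.arcIntegral_const_mul, h1] at h2
  refine Eq.trans ?_ (h2.trans ?_)
  · refine IsRegularCurve.arcIntegral_congr (γ := γ t) (f := fun x =>
      2 * (curvature (γ t) x * arcDeriv (γ t) (arcDeriv (γ t) (normalSpeed m (γ t))) x) +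
        curvature (γ t) x * curvature (γ t) x * curvature (γ t) x * normalSpeed m (γ t) x)
      fun x hx => ?_
    simp only [Pi.add_apply, Pi.mul_apply, hγ.arcDeriv_arcDeriv_normalSpeed m hx, normalSpeed]
    ring
  · have : ((-1 : ℝ) ^ m) * (-1) ^ m = 1 := by rw [← mul_pow]; simp
    rw [pow_succ]
    linear_combination (-2 * curvatureNorm (γ t) (m + 2) ^ 2) * this

end IsSolution
/-! ### Continuity up to the initial time -/

/-- Expresses k through γ_x and γ_xx alone, the derivatives assumed continuous up to t = 0. -/
theorem IsRegularCurve.curvature_eq {γ : ℝ → Plane} (hγ : IsRegularCurve γ) {x : ℝ} (hx : x ∈ I) :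
    curvature γ x = (velocity γ x 0 * derivWithin (velocity γ) I x 1 -
      velocity γ x 1 * derivWithin (velocity γ) I x 0) * (speed γ x)⁻¹ ^ 3 := by
  have hv := (hγ.speed_pos hx).ne'
  have hinv := hasDerivWithinAt_of_smooth (hγ.smooth_speed.inv fun y hy => (hγ.speed_pos hy).ne') hx
  have hT : ∀ i, derivWithin (fun y => tangent γ y i) I x = _ := fun i =>
    (hinv.fun_mul (hasDerivWithinAt_of_smooth
      (contDiffOn_euclidean.1 hγ.smooth_velocity i) hx)).derivWithin (uniqueDiffOn_I x hx)
  have hk := hγ.curvature_mul_speed hx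
  rw [hT, hT, derivWithin_apply hγ.smooth_velocity 0 hx, derivWithin_apply hγ.smooth_velocity 1 hx,
    hγ.velocity_apply hx, hγ.velocity_apply hx, Pi.inv_apply] at hk
  rw [hγ.velocity_apply hx, hγ.velocity_apply hx]
  field_simp at hk ⊢
  linear_combination hk

namespace IsSolution

variable {m : ℕ} {e : Plane} {a b T : ℝ} {γ : ℝ → ℝ → Plane}

theorem continuousOn_velocity (h : IsSolution m e a b T γ) :
    ContinuousOn (fun p : ℝ × ℝ => velocity (γ p.1) p.2) (Set.Ico 0 T ×ˢ I) := by
  have := h.continuous_initial 1 (by norm_num)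
  simp only [iteratedDerivWithin_one] at this
  exact this

theorem continuousOn_speed (h : IsSolution m e a b T γ) :
    ContinuousOn (fun p : ℝ × ℝ => speed (γ p.1) p.2) (Set.Ico 0 T ×ˢ I) :=
  h.continuousOn_velocity.norm

theorem continuousOn_curvature (h : IsSolution m e a b T γ) :
    ContinuousOn (fun p : ℝ × ℝ => curvature (γ p.1) p.2) (Set.Ico 0 T ×ˢ I) := by
  have hA : ContinuousOn (fun p : ℝ × ℝ => derivWithin (velocity (γ p.1)) I p.2)
      (Set.Ico 0 T ×ˢ I) := by
    have := h.continuous_initial 2 le_rfl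
    simp only [iteratedDerivWithin_succ, iteratedDerivWithin_zero] at this
    exact this
  have hi : ∀ {f : ℝ × ℝ → Plane}, ContinuousOn f (Set.Ico 0 T ×ˢ I) → ∀ i : Fin 2,
      ContinuousOn (fun p => f p i) (Set.Ico 0 T ×ˢ I) := fun hf i =>
    (EuclideanSpace.proj (𝕜 := ℝ) i).continuous.comp_continuousOn hf
  have hV := hi h.continuousOn_velocity
  have hv := h.continuousOn_speed.inv₀ fun p hp =>
    ((h.neumann p.1 hp.1).isRegularCurve.speed_pos hp.2).ne'
  exact ((((hV 0).mul (hi hA 1)).sub ((hV 1).mul (hi hA 0))).mul (hv.pow 3)).congr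
    fun p hp => (h.neumann p.1 hp.1).isRegularCurve.curvature_eq hp.2

theorem continuousOn_length (h : IsSolution m e a b T γ) :
    ContinuousOn (fun t => length (γ t)) (Set.Ico 0 T) :=
  continuousOn_integral h.continuousOn_speed

theorem continuousOn_curvatureEnergy (h : IsSolution m e a b T γ) :
    ContinuousOn (fun t => curvatureEnergy (γ t)) (Set.Ico 0 T) :=
  continuousOn_integral ((h.continuousOn_curvature.pow 2).mul h.continuousOn_speed)

/-! ### Decay of the energy -/

/-- Allows the initial length to replace L(t) in the smallness condition and in the decay rate. -/
theorem length_le (h : IsSolution m e a b T γ) {t : ℝ} (ht : t ∈ Set.Ico 0 T) :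
    length (γ t) ≤ length (γ 0) := by
  have hanti : AntitoneOn (fun t => length (γ t)) (Set.Ico 0 T) := by
    refine antitoneOn_of_deriv_nonpos (convex_Ico 0 T) h.continuousOn_length ?_ ?_ <;>
      rw [interior_Ico]
    · exact fun t ht => (h.hasDerivAt_length ht).differentiableAt.differentiableWithinAt
    · intro t ht
      rw [(h.hasDerivAt_length ht).deriv]
      exact neg_nonpos.2 (sq_nonneg _)
  exact hanti ⟨le_rfl, ht.1.trans_lt ht.2⟩ ht ht.1

/-- The energy decays exponentially as long as it is small. -/
theorem deriv_curvatureEnergy_le (h : IsSolution m e a b T γ) (he : ‖e‖ = 1) {t : ℝ}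
    (ht : t ∈ Set.Ioo 0 T)
    (hsmall : 3 ^ (m + 1) * (length (γ 0) * curvatureEnergy (γ t)) < 1) :
    deriv (fun s => curvatureEnergy (γ s)) t ≤
      -((length (γ 0) ^ (2 * (m + 2)))⁻¹ * curvatureEnergy (γ t)) := by
  have hN := h.isNeumannCurve ht
  have hL := hN.isRegularCurve.length_pos
  have hLL := h.length_le ⟨ht.1.le, ht.2⟩
  have hE : 0 ≤ curvatureEnergy (γ t) := curvatureNorm_zero_sq (γ t) ▸ sq_nonneg _
  have h3 : (1 : ℝ) ≤ 3 ^ (m + 1) := one_le_pow₀ (by norm_num)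
  have hLE : length (γ t) * curvatureEnergy (γ t) ≤ length (γ 0) * curvatureEnergy (γ t) :=
    mul_le_mul_of_nonneg_right hLL hE
  have hLE0 : 0 ≤ length (γ t) * curvatureEnergy (γ t) := mul_nonneg hL.le hE
  have h3LE : 3 ^ (m + 1) * (length (γ t) * curvatureEnergy (γ t)) < 1 :=
    (mul_le_mul_of_nonneg_left hLE (by positivity)).trans_lt hsmall
  have hsm : length (γ t) * curvatureEnergy (γ t) < 1 :=
    (le_mul_of_one_le_left hLE0 h3).trans_lt h3LE
  have hr := hN.abs_arcIntegral_reaction_le he hsm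
  have hp := hN.curvatureEnergy_le he hsm
  rw [(h.hasDerivAt_curvatureEnergy he ht).deriv]
  set R := arcIntegral (γ t) ((curvature (γ t) * curvature (γ t) * curvature (γ t)) *
    curvatureDeriv (γ t) (2 * m + 2))
  set M := curvatureNorm (γ t) (m + 2)
  -- The reaction term uses up at most one of the two copies of M² in the dissipation; the other
  -- gives decay.
  have hR : (-1) ^ (m + 1) * R ≤ M ^ 2 := by
    calc (-1) ^ (m + 1) * R ≤ |(-1) ^ (m + 1) * R| := le_abs_self _
      _ = |R| := by rw [abs_mul, abs_pow, abs_neg, abs_one, one_pow, one_mul]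
      _ ≤ 3 ^ (m + 1) * (length (γ t) * curvatureEnergy (γ t)) * M ^ 2 := by
        rw [mul_assoc]; exact hr
      _ ≤ M ^ 2 := mul_le_of_le_one_left (sq_nonneg _) h3LE.le
  have hM : (length (γ 0) ^ (2 * (m + 2)))⁻¹ * curvatureEnergy (γ t) ≤ M ^ 2 := by
    rw [inv_mul_le_iff₀ (pow_pos (hL.trans_le hLL) _)]
    exact hp.trans (mul_le_mul_of_nonneg_right (pow_le_pow_left₀ hL.le hLL _) (sq_nonneg _))
  linarith

/-- Smallness of the energy is preserved. -/
theorem curvatureEnergy_le_of_small (h : IsSolution m e a b T γ) (he : ‖e‖ = 1) {c : ℝ}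
    (hc : 3 ^ (m + 1) * (length (γ 0) * c) < 1) (h0 : curvatureEnergy (γ 0) ≤ c)
    {t : ℝ} (ht : t ∈ Set.Ico 0 T) : curvatureEnergy (γ t) ≤ c := by
  have hL : 0 < length (γ 0) :=
    (h.neumann 0 ⟨le_rfl, ht.1.trans_lt ht.2⟩).isRegularCurve.length_pos
  have hcont : ContinuousOn (fun s => curvatureEnergy (γ s)) (Set.Icc 0 t) :=
    h.continuousOn_curvatureEnergy.mono (Set.Icc_subset_Ico_right ht.2)
  have hclosed : IsClosed ({s | curvatureEnergy (γ s) ≤ c} ∩ Set.Icc 0 t) := by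
    rw [Set.inter_comm]
    exact hcont.preimage_isClosed_of_isClosed isClosed_Icc isClosed_Iic
  -- Continuous induction: the set of good times is closed, so it suffices to continue slightly
  -- beyond each good s < t.
  refine hclosed.Icc_subset_of_forall_exists_gt h0 (fun s hs y hy => ?_) ⟨ht.1, le_rfl⟩
  have hsT : s ∈ Set.Ico 0 T := ⟨hs.2.1, hs.2.2.trans ht.2⟩
  -- The strict inequality `hc` leaves room: the energy stays in the range of
  -- `deriv_curvatureEnergy_le` just after s, and so does not increase there.
  have hev : ∀ᶠ r in nhdsWithin s (Set.Ici s),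
      3 ^ (m + 1) * (length (γ 0) * curvatureEnergy (γ r)) < 1 := by
    have hcs : ContinuousWithinAt (fun r => 3 ^ (m + 1) * (length (γ 0) * curvatureEnergy (γ r)))
        (Set.Ici s) s := by
      refine continuousWithinAt_const.mul (continuousWithinAt_const.mul ?_)
      refine (h.continuousOn_curvatureEnergy s hsT).mono_of_mem_nhdsWithin ?_
      exact Filter.mem_of_superset (Ico_mem_nhdsGE hsT.2)
        (Set.Ico_subset_Ico_left hsT.1)
    refine hcs.eventually_lt continuousWithinAt_const (lt_of_le_of_lt ?_ hc)
    have hsc : curvatureEnergy (γ s) ≤ c := hs.1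
    exact mul_le_mul_of_nonneg_left (mul_le_mul_of_nonneg_left hsc hL.le) (by positivity)
  obtain ⟨r, hr, hrs⟩ := (mem_nhdsGE_iff_exists_Icc_subset).1 hev
  have hsr : s < r := hr
  set z := min (min r y) t with hz
  have hsz : s < z := lt_min (lt_min hsr hy) hs.2.2
  have hzT : z < T := (min_le_right _ _).trans_lt ht.2
  refine ⟨z, ?_, hsz, (min_le_left _ _).trans (min_le_right _ _)⟩
  have hanti : AntitoneOn (fun r => curvatureEnergy (γ r)) (Set.Icc s z) := by
    refine antitoneOn_of_deriv_nonpos (convex_Icc s z) (h.continuousOn_curvatureEnergy.mono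
      fun r hr => ⟨hsT.1.trans hr.1, hr.2.trans_lt hzT⟩) ?_ ?_ <;> rw [interior_Icc]
    · exact fun r hr => (h.hasDerivAt_curvatureEnergy he ⟨hsT.1.trans_lt hr.1,
        hr.2.trans hzT⟩).differentiableAt.differentiableWithinAt
    · intro q hq
      refine (h.deriv_curvatureEnergy_le he ⟨hsT.1.trans_lt hq.1, hq.2.trans hzT⟩
        (hrs ⟨hq.1.le, hq.2.le.trans ((min_le_left _ _).trans (min_le_left _ _))⟩)).trans ?_
      exact neg_nonpos.2 (mul_nonneg (inv_nonneg.2 (pow_nonneg hL.le _))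
        (curvatureNorm_zero_sq (γ q) ▸ sq_nonneg _))
  exact (hanti ⟨le_rfl, hsz.le⟩ ⟨hsz.le, le_rfl⟩ hsz.le).trans hs.1

theorem curvatureEnergy_decay (h : IsSolution m e a b T γ) (he : ‖e‖ = 1)
    (hc : 3 ^ (m + 1) * (length (γ 0) * curvatureEnergy (γ 0)) < 1) {t : ℝ}
    (ht : t ∈ Set.Ico 0 T) :
    curvatureEnergy (γ t) ≤
      curvatureEnergy (γ 0) * Real.exp (-(length (γ 0) ^ (2 * (m + 2)))⁻¹ * t) := by
  set δ := (length (γ 0) ^ (2 * (m + 2)))⁻¹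
  have hL : 0 < length (γ 0) :=
    (h.neumann 0 ⟨le_rfl, ht.1.trans_lt ht.2⟩).isRegularCurve.length_pos
  have hexp : ∀ s, HasDerivAt (fun s => Real.exp (δ * s)) (Real.exp (δ * s) * δ) s := fun s => by
    simpa using ((hasDerivAt_id s).const_mul δ).exp
  -- Grönwall's argument with the integrating factor exp(δ s).
  have hanti : AntitoneOn (fun s => curvatureEnergy (γ s) * Real.exp (δ * s)) (Set.Ico 0 T) := by
    refine antitoneOn_of_deriv_nonpos (convex_Ico 0 T)
      (h.continuousOn_curvatureEnergy.mul (by fun_prop)) ?_ ?_ <;> rw [interior_Ico]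
    · exact fun s hs => ((h.hasDerivAt_curvatureEnergy he hs).mul
        (hexp s)).differentiableAt.differentiableWithinAt
    · intro s hs
      have hd := (h.hasDerivAt_curvatureEnergy he hs).differentiableAt.hasDerivAt
      rw [(hd.fun_mul (hexp s)).deriv]
      have hle := h.curvatureEnergy_le_of_small he hc le_rfl ⟨hs.1.le, hs.2⟩
      have hsm : 3 ^ (m + 1) * (length (γ 0) * curvatureEnergy (γ s)) < 1 := by
        refine lt_of_le_of_lt ?_ hc
        gcongr
      have := mul_le_mul_of_nonneg_right (h.deriv_curvatureEnergy_le he hs hsm)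
        (Real.exp_pos (δ * s)).le
      linarith
  have := hanti ⟨le_rfl, ht.1.trans_lt ht.2⟩ ht ht.1
  simp only [mul_zero, Real.exp_zero, mul_one] at this
  rwa [neg_mul, Real.exp_neg, ← div_eq_mul_inv, le_div_iff₀ (Real.exp_pos _)]

end IsSolution
end PolyFlow

theorem proposition3p2 (m : ℕ) :
    ∃ ε : ℝ, 0 < ε ∧ ∀ L₀ : ℝ, 0 < L₀ → ∃ δ : ℝ, 0 < δ ∧
      ∀ (e : PolyFlow.Plane) (a b T : ℝ) (γ : ℝ → ℝ → PolyFlow.Plane),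
        ‖e‖ = 1 → a < b → PolyFlow.IsSolution m e a b T γ →
        PolyFlow.length (γ 0) = L₀ →
        L₀ * PolyFlow.curvatureEnergy (γ 0) ≤ ε →
        ∀ t ∈ Set.Ico 0 T,
          PolyFlow.curvatureEnergy (γ t) ≤
            PolyFlow.curvatureEnergy (γ 0) * Real.exp (-δ * t) := by
  -- The factor 3 ^ (m + 1) is the constant of the reaction estimate, and the 2 makes the smallness
  -- strict. The rate comes from the Poincaré constant of m + 2 derivatives.
  refine ⟨(2 * 3 ^ (m + 1))⁻¹, by positivity, fun L₀ hL₀ =>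
    ⟨(L₀ ^ (2 * (m + 2)))⁻¹, by positivity, ?_⟩⟩
  rintro e a b T γ he - h rfl hε t ht
  refine h.curvatureEnergy_decay he ?_ ht
  calc (3 : ℝ) ^ (m + 1) * (PolyFlow.length (γ 0) * PolyFlow.curvatureEnergy (γ 0))
      ≤ 3 ^ (m + 1) * (2 * 3 ^ (m + 1))⁻¹ := by gcongr
    _ = 1 / 2 := by field_simp
    _ < 1 := by norm_num
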